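/- For a domain $D\subset\mathbb C^n$ (a non-empty connected open set), let $d_D(z)=\operatorname{dist}(z,\partial D)$ be the Euclidean distance from $z\in D$ to the boundary of $D$, and let $$c_D(z,w)=\sup\{\tanh^{-1}|f(w)| : f:D\to\mathbb D \text{ holomorphic},\ f(z)=0\},\qquad z,w\in D,$$ be the Carathéodory distance of $D$, where $\mathbb D$ is the open unit disc in $\mathbb C$. Call $D$ proper if $D\ne\mathbb C^n$. An open set $D\subset\mathbb C^n$ is called $\mathbb C$-convex if every non-empty intersection of $D$ with a complex line is a simply connected domain in that line. (i) Let $D$ be a proper convex domain in $\mathbb C^n$. Then for all $z,w\in D$ $$c_D(z,w)\ge\frac12\log\frac{d_D(z)}{d_D(w)}.$$ Moreover, if $n=1$, then for all $z,w\in D$ $$c_D(z,w)\ge\frac12\log\left(1+\frac{|z-w|}{d_D(w)}\right).$$ (ii) Let $D$ be a proper $\mathbb C$-convex domain in $\mathbb C^n$. Then for all $z,w\in D$ $$c_D(z,w)\ge\frac14\log\frac{d_D(z)}{d_D(w)}.$$ Moreover, if $n=1$, then for all $z,w\in D$ $$c_D(z,w)\ge\frac14\log\left(1+\frac{|z-w|}{d_D(w)}\right).$$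 The constants $\frac12$ and $\frac14$ are sharp, already for $n=1$. For every $C>\frac12$, each of the two inequalities in (i) with $\frac12$ replaced by $C$ fails for some pair of points of the (proper convex) domain $D=\mathbb D$. The domain $D=\mathbb C\setminus[0,\infty)$ is proper and $\mathbb C$-convex, and for every $C>\frac14$, each of the two inequalities in (ii) with $\frac14$ replaced by $C$ fails for some pair of points of it. -/

import Mathlib

/-- A domain: a non-empty connected open set. -/
def IsDomainSet {E : Type*} [TopologicalSpace E] (D : Set E) : Prop :=
  IsOpen D ∧ IsConnected D

/-- The complex line through `a` in the direction `v` (for `v ≠ 0`). -/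
def complexLine {E : Type*} [AddCommGroup E] [Module ℂ E] (a v : E) : Set E :=
  Set.range fun t : ℂ => a + t • v

/-- `ℂ`-convexity of an open set: every non-empty intersection with a complex line is a simply
connected domain of this line. For an open set `D` these intersections are open in the line, and
simple connectedness includes path connectedness. -/
def IsCConvex {E : Type*} [NormedAddCommGroup E] [NormedSpace ℂ E] (D : Set E) : Prop :=
  IsOpen D ∧ ∀ a v : E, v ≠ 0 → (D ∩ complexLine a v).Nonempty →
    IsSimplyConnected (D ∩ complexLine a v)

/-- The Carathéodory distance `c_D(z, w)`: the supremum of `artanh |f w|` over the holomorphic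
functions `f` from `D` to the open unit disc with `f z = 0`. The supremum is taken in the extended
reals, so that it needs no convention for unbounded sets. -/
noncomputable def caratheodoryDist {E : Type*} [NormedAddCommGroup E] [NormedSpace ℂ E]
    (D : Set E) (z w : E) : EReal :=
  sSup {x : EReal | ∃ f : E → ℂ, DifferentiableOn ℂ f D ∧ Set.MapsTo f D (Metric.ball 0 1) ∧
    f z = 0 ∧ x = ((Real.artanh ‖f w‖ : ℝ) : EReal)}

/-- The distance `d_D(z)` from `z` to the boundary of `D`. -/
noncomputable def boundaryDist {E : Type*} [NormedAddCommGroup E] (D : Set E) (z : E) : ℝ :=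
  Metric.infDist z (frontier D)

/-- The complex plane without the closed half-line of the non-negative reals. -/
def slitDomain : Set ℂ := {ζ : ℂ | ¬ (0 ≤ ζ.re ∧ ζ.im = 0)}

/-! Lower bounds for `caratheodoryDist` come from holomorphic maps to simpler domains, since such
maps decrease it. Upper bounds, for sharpness, come from discs mapped into the domain, by the
Schwarz lemma. Convex case: a boundary point nearest to `w` has a supporting real hyperplane. The
corresponding complex linear functional maps `D` into a half-plane, where a Möbius map to the disc
gives the factor 1/2. ℂ-convex case: let `p` be a boundary point nearest to `w`. The complex
hyperplane through `p` orthogonal to `w - p` misses `D` (`IsCConvex.inner_ne_zero`). Otherwise the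
complex lines through `p` close to a line in that hyperplane would carry a continuous, single-valued
logarithm of a loop of winding number -1. Projecting along the hyperplane gives a plane domain
omitting a point; it inherits holomorphic logarithms (`IsCConvex.hasLogs_image`), because continuous
logarithms exist on `D` and the fibres of the projection are connected. On a plane domain with
logarithms the factor 1/4 comes from Koebe's quarter theorem (`HasLogs.norm_deriv_le`). A square
root reduces it to the bound |F'(0)| ≤ 1 for Bieberbach–Eilenberg functions, which is proved by
determinants. Integrating the invariant form along a hyperbolic geodesic gives a growth estimate,
and nearly surjective disc charts (`HasLogs.exists_disc_chart`) turn it into a bound for the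
distance. Radial points of the disc show that 1/2 is sharp; the Koebe-type map onto the slit plane
gives equality with 1/4. -/

section

open Complex Metric Set Filter Topology

/-! ### Taylor coefficients and the Bieberbach–Eilenberg bound -/

/-- The `k`-th Taylor coefficient at `0`, as a Cauchy integral over the circle of radius `r`. -/
noncomputable def taylorCoeffIntegral (r : ℝ) (k : ℕ) (f : ℂ → ℂ) : ℂ :=
  (2 * Real.pi * I : ℂ)⁻¹ • ∮ z in C(0, r), f z / z ^ (k + 1)

lemma sphere_ne_zero {r : ℝ} (hr : 0 < r) {z : ℂ} (hz : z ∈ sphere (0 : ℂ) r) : z ≠ 0 := by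
  rintro rfl; simp at hz; linarith

lemma taylorCoeffIntegral_congr {r : ℝ} (hr : 0 < r) {k : ℕ} {f g : ℂ → ℂ}
    (h : ∀ z ∈ sphere (0 : ℂ) r, f z = g z) :
    taylorCoeffIntegral r k f = taylorCoeffIntegral r k g := by
  unfold taylorCoeffIntegral
  congr 1
  refine circleIntegral.integral_congr hr.le fun z hz => ?_
  simp only [h z hz]

lemma circleIntegrable_div_pow {r : ℝ} (hr : 0 < r) (k : ℕ) {f : ℂ → ℂ}
    (hf : ContinuousOn f (sphere 0 r)) : CircleIntegrable (fun z => f z / z ^ (k + 1)) 0 r := by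
  refine ContinuousOn.circleIntegrable hr.le ?_
  refine hf.div (by fun_prop) fun z hz => pow_ne_zero _ (sphere_ne_zero hr hz)

lemma taylorCoeffIntegral_add {r : ℝ} (hr : 0 < r) (k : ℕ) {f g : ℂ → ℂ}
    (hf : ContinuousOn f (sphere 0 r)) (hg : ContinuousOn g (sphere 0 r)) :
    taylorCoeffIntegral r k (fun z => f z + g z) =
      taylorCoeffIntegral r k f + taylorCoeffIntegral r k g := by
  unfold taylorCoeffIntegral
  rw [← smul_add, ← circleIntegral.integral_add (circleIntegrable_div_pow hr k hf)
    (circleIntegrable_div_pow hr k hg)]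
  simp only [add_div]

lemma taylorCoeffIntegral_const_mul (r : ℝ) (k : ℕ) (c : ℂ) (f : ℂ → ℂ) :
    taylorCoeffIntegral r k (fun z => c * f z) = c * taylorCoeffIntegral r k f := by
  unfold taylorCoeffIntegral
  simp only [mul_div_assoc, circleIntegral.integral_const_mul, smul_eq_mul]
  ring

lemma taylorCoeffIntegral_sum {r : ℝ} (hr : 0 < r) (k : ℕ) {ι : Type*} (s : Finset ι)
    (c : ι → ℂ) {f : ι → ℂ → ℂ} (hf : ∀ i, ContinuousOn (f i) (sphere 0 r)) :
    taylorCoeffIntegral r k (fun z => ∑ i ∈ s, c i * f i z) =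
      ∑ i ∈ s, c i * taylorCoeffIntegral r k (f i) := by
  classical
  induction s using Finset.induction_on with
  | empty => simp [taylorCoeffIntegral, circleIntegral]
  | insert a s ha ih =>
    simp only [Finset.sum_insert ha]
    rw [taylorCoeffIntegral_add hr k (continuousOn_const.fun_mul (hf a))
      (continuousOn_finsetSum s fun i _ => continuousOn_const.fun_mul (hf i)),
      taylorCoeffIntegral_const_mul, ih]

lemma norm_taylorCoeffIntegral_mul_le {r : ℝ} (hr : 0 < r) (k : ℕ) {f : ℂ → ℂ} {M : ℝ}
    (hM : ∀ z ∈ sphere (0 : ℂ) r, ‖f z‖ ≤ M) : r ^ k * ‖taylorCoeffIntegral r k f‖ ≤ M := by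
  have h : ‖taylorCoeffIntegral r k f‖ ≤ r * (M / r ^ (k + 1)) := by
    refine circleIntegral.norm_two_pi_i_inv_smul_integral_le_of_norm_le_const hr.le fun z hz => ?_
    rw [norm_div, norm_pow, mem_sphere_zero_iff_norm.1 hz]
    gcongr
    exact hM z hz
  calc r ^ k * ‖taylorCoeffIntegral r k f‖ ≤ r ^ k * (r * (M / r ^ (k + 1))) := by gcongr
    _ = M := by rw [pow_succ]; field_simp

lemma taylorCoeffIntegral_pow_mul_eq_zero {r : ℝ} (hr : 0 < r) (hr1 : r < 1) {k n : ℕ}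
    (hkn : k < n) {g : ℂ → ℂ} (hg : DifferentiableOn ℂ g (ball 0 1)) :
    taylorCoeffIntegral r k (fun z => z ^ n * g z) = 0 := by
  obtain ⟨m, rfl⟩ := Nat.exists_eq_add_of_lt hkn
  have hsub : closedBall (0 : ℂ) r ⊆ ball 0 1 := closedBall_subset_ball hr1
  have h : ∮ z in C(0, r), z ^ (k + m + 1) * g z / z ^ (k + 1) = ∮ z in C(0, r), z ^ m * g z := by
    refine circleIntegral.integral_congr hr.le fun z hz => ?_
    have := sphere_ne_zero hr hz
    rw [div_eq_iff (pow_ne_zero _ this)]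
    ring
  have hd : DifferentiableOn ℂ (fun z => z ^ m * g z) (ball 0 1) := by fun_prop
  have h0 : ∮ z in C(0, r), z ^ m * g z = 0 :=
    circleIntegral_eq_zero_of_differentiable_on_off_countable hr.le countable_empty
      (hd.continuousOn.mono hsub)
      fun z hz => (hd z (hsub (ball_subset_closedBall hz.1))).differentiableAt
        (isOpen_ball.mem_nhds (hsub (ball_subset_closedBall hz.1)))
  rw [taylorCoeffIntegral, h, h0, smul_zero]

lemma taylorCoeffIntegral_pow_mul_self {r : ℝ} (hr : 0 < r) (hr1 : r < 1) (n : ℕ) {g : ℂ → ℂ}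
    (hg : DifferentiableOn ℂ g (ball 0 1)) :
    taylorCoeffIntegral r n (fun z => z ^ n * g z) = g 0 := by
  have hsub : closedBall (0 : ℂ) r ⊆ ball 0 1 := closedBall_subset_ball hr1
  have h : ∮ z in C(0, r), z ^ n * g z / z ^ (n + 1) = ∮ z in C(0, r), (z - 0)⁻¹ • g z := by
    refine circleIntegral.integral_congr hr.le fun z hz => ?_
    have := sphere_ne_zero hr hz
    simp only [sub_zero, smul_eq_mul]
    rw [pow_succ]
    field_simp
  rw [taylorCoeffIntegral, h]
  exact two_pi_I_inv_smul_circleIntegral_sub_inv_smul_of_differentiable_on_off_countable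
    countable_empty (mem_ball_self hr) (hg.continuousOn.mono hsub)
    fun z hz => (hg z (hsub (ball_subset_closedBall hz.1))).differentiableAt
        (isOpen_ball.mem_nhds (hsub (ball_subset_closedBall hz.1)))

/-- The inequality behind the coefficient bound for Bieberbach–Eilenberg functions: it compares the
determinant of the Taylor coefficients of `1 / (1 - F z * F ζ)` with its trivial bound. -/
lemma pow_le_of_mul_ne_one {F : ℂ → ℂ} (hF : DifferentiableOn ℂ F (ball 0 1)) (h0 : F 0 = 0)
    (hne : ∀ z ∈ ball (0 : ℂ) 1, ∀ ζ ∈ ball (0 : ℂ) 1, F z * F ζ ≠ 1) {r : ℝ} (hr : 0 < r)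
    (hr1 : r < 1) :
    ∃ M : ℝ, ∀ N : ℕ, (∏ n ∈ Finset.range N, (r * ‖deriv F 0‖) ^ n) ^ 2 ≤ N.factorial * M ^ N := by
  have hsub : sphere (0 : ℂ) r ⊆ ball 0 1 :=
    sphere_subset_closedBall.trans (closedBall_subset_ball hr1)
  set q := dslope F 0 with hq
  have hqd : DifferentiableOn ℂ q (ball 0 1) :=
    (differentiableOn_dslope (isOpen_ball.mem_nhds (mem_ball_self one_pos))).2 hF
  have hFq : ∀ z, F z = z * q z := by
    intro z
    have := sub_smul_dslope F 0 z
    simp only [sub_zero, smul_eq_mul, h0] at this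
    exact this.symm
  have hq0 : q 0 = deriv F 0 := dslope_same F 0
  have hFs : ContinuousOn F (sphere 0 r) := hF.continuousOn.mono hsub
  obtain ⟨M, hM⟩ : ∃ M : ℝ, ∀ p ∈ sphere (0 : ℂ) r ×ˢ sphere (0 : ℂ) r,
      ‖(1 - F p.1 * F p.2)⁻¹‖ ≤ M := by
    refine ((isCompact_sphere _ _).prod (isCompact_sphere _ _)).exists_bound_of_continuousOn ?_
    refine ContinuousOn.inv₀ ?_ fun p hp => sub_ne_zero.2 (hne _ (hsub hp.1) _ (hsub hp.2)).symm
    exact continuousOn_const.sub ((hFs.comp continuousOn_fst fun p hp => hp.1).mul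
      (hFs.comp continuousOn_snd fun p hp => hp.2))
  refine ⟨M, fun N => ?_⟩
  -- Row `n` lists the coefficients of `F ^ n`, with weights `r ^ j`. As `F ^ n` vanishes to order
  -- `n` at 0, the matrix is upper triangular with diagonal `(r * F'(0)) ^ n`.
  set A : Matrix (Fin N) (Fin N) ℂ := Matrix.of fun n j =>
    (r : ℂ) ^ (j : ℕ) * taylorCoeffIntegral r j (fun z => F z ^ (n : ℕ)) with hA
  have hpow : ∀ (n : ℕ), (fun z => F z ^ n) = fun z => z ^ n * q z ^ n := fun n => by
    funext z; rw [hFq, mul_pow]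
  have htri : A.BlockTriangular id := by
    intro i j (hij : (j : ℕ) < i)
    simp only [hA, hpow, Matrix.of_apply]
    rw [taylorCoeffIntegral_pow_mul_eq_zero hr hr1 hij (hqd.fun_pow _), mul_zero]
  have hdet : A.det = ∏ n ∈ Finset.range N, ((r : ℂ) * deriv F 0) ^ n := by
    rw [Matrix.det_of_isUpperTriangular htri, Finset.prod_range]
    refine Finset.prod_congr rfl fun i _ => ?_
    simp only [hA, hpow, Matrix.of_apply]
    rw [taylorCoeffIntegral_pow_mul_self hr hr1 _ (hqd.fun_pow _), mul_pow]
    simp [hq0]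
  have hker : ∀ z ∈ sphere (0 : ℂ) r, ∀ k < N,
      taylorCoeffIntegral r k (fun ζ => (1 - F z * F ζ)⁻¹) =
        ∑ n : Fin N, F z ^ (n : ℕ) * taylorCoeffIntegral r k (fun ζ => F ζ ^ (n : ℕ)) := by
    intro z hz k hk
    have hn : ∀ ζ ∈ ball (0 : ℂ) 1, 1 - F z * F ζ ≠ 0 := fun ζ hζ =>
      sub_ne_zero.2 (hne _ (hsub hz) _ hζ).symm
    -- Truncated geometric series: the remainder carries the factor `ζ ^ N`, so it does not affect
    -- coefficients of index below `N`.
    have e : ∀ ζ ∈ sphere (0 : ℂ) r, (1 - F z * F ζ)⁻¹ =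
        (∑ n : Fin N, F z ^ (n : ℕ) * F ζ ^ (n : ℕ)) +
          ζ ^ N * (F z ^ N * q ζ ^ N * (1 - F z * F ζ)⁻¹) := by
      intro ζ hζ
      have h1 := hn ζ (hsub hζ)
      have h2 := mul_neg_geom_sum (F z * F ζ) N
      rw [Finset.sum_range] at h2
      simp only [mul_pow] at h2
      have h3 : F ζ ^ N = ζ ^ N * q ζ ^ N := by rw [hFq, mul_pow]
      rw [eq_comm, ← mul_right_inj' h1, mul_add, h2, mul_inv_cancel₀ h1, h3]
      field_simp
      ring
    rw [taylorCoeffIntegral_congr hr e, taylorCoeffIntegral_add hr,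
      taylorCoeffIntegral_sum hr k _ _ fun i => hFs.fun_pow _,
      taylorCoeffIntegral_pow_mul_eq_zero hr hr1 hk, add_zero]
    · refine (DifferentiableOn.const_mul (hqd.pow N) _).mul
        (DifferentiableOn.inv ((hF.const_mul _).const_sub _) hn)
    · exact continuousOn_finsetSum _ fun i _ => continuousOn_const.mul (hFs.fun_pow _)
    · refine (continuousOn_id.pow N).mul ((continuousOn_const.mul
        ((hqd.continuousOn.mono hsub).pow N)).mul (ContinuousOn.inv₀ ?_ fun ζ hζ => hn ζ (hsub hζ)))
      exact continuousOn_const.sub (continuousOn_const.mul hFs)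
  -- The entry is `r ^ (j + k)` times the coefficient of `z ^ j * ζ ^ k` in the kernel `(1 - F z * F
  -- ζ)⁻¹`; two Cauchy estimates bound it by the supremum of the kernel on the torus.
  have hentry : ∀ j k : Fin N, ‖(A.transpose * A) j k‖ ≤ M := by
    intro j k
    have e : (A.transpose * A) j k = (r : ℂ) ^ (j : ℕ) * taylorCoeffIntegral r j
        (fun z => (r : ℂ) ^ (k : ℕ) *
          taylorCoeffIntegral r k (fun ζ => (1 - F z * F ζ)⁻¹)) := by
      rw [taylorCoeffIntegral_congr hr (fun z hz => by rw [hker z hz k k.2]),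
        taylorCoeffIntegral_const_mul,
        taylorCoeffIntegral_congr hr (g := fun z => ∑ n : Fin N,
          taylorCoeffIntegral r k (fun ζ => F ζ ^ (n : ℕ)) * F z ^ (n : ℕ))
          (fun z hz => Finset.sum_congr rfl fun n _ => mul_comm _ _),
        taylorCoeffIntegral_sum hr _ _ _ fun i => hFs.fun_pow _]
      simp only [Matrix.mul_apply, Matrix.transpose_apply, hA, Matrix.of_apply, Finset.mul_sum]
      refine Finset.sum_congr rfl fun n _ => ?_
      ring
    rw [e, norm_mul, norm_pow, norm_real, Real.norm_of_nonneg hr.le]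
    refine norm_taylorCoeffIntegral_mul_le hr _ fun z hz => ?_
    rw [norm_mul, norm_pow, norm_real, Real.norm_of_nonneg hr.le]
    exact norm_taylorCoeffIntegral_mul_le hr _ fun ζ hζ => hM (z, ζ) ⟨hz, hζ⟩
  have := Matrix.det_le (abv := IsAbsoluteValue.toAbsoluteValue (norm : ℂ → ℝ)) hentry
  simp only [Fintype.card_fin, nsmul_eq_mul] at this
  have h2 : ‖(A.transpose * A).det‖ ≤ N.factorial * M ^ N := this
  rw [Matrix.det_mul, Matrix.det_transpose, hdet, ← pow_two, norm_pow, norm_prod] at h2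
  simpa only [norm_pow, norm_mul, norm_real, Real.norm_of_nonneg hr.le] using h2

/-- The left side is `x ^ (N * (N - 1))`, quadratic in the exponent, while the right side grows only
like `exp (N log N)`. Taking `(N + 1)`-th roots at index `N + 1` leaves `x ^ N ≤ (N + 1) * M`,
impossible for `x > 1`. -/
lemma le_one_of_prod_pow_le {x M : ℝ}
    (h : ∀ N : ℕ, (∏ n ∈ Finset.range N, x ^ n) ^ 2 ≤ N.factorial * M ^ N) : x ≤ 1 := by
  by_contra! hx1
  have hM : 0 ≤ M := by
    have := h 1
    simp at this
    linarith
  have key : ∀ N : ℕ, x ^ N ≤ (N + 1) * M := by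
    intro N
    have h1 := h (N + 1)
    rw [Finset.prod_pow_eq_pow_sum, ← pow_mul, Finset.sum_range_id_mul_two] at h1
    have h2 : ((N + 1).factorial : ℝ) ≤ ((N + 1 : ℕ) : ℝ) ^ (N + 1) := by
      exact_mod_cast Nat.factorial_le_pow (N + 1)
    have h3 : (x ^ N) ^ (N + 1) ≤ (((N : ℝ) + 1) * M) ^ (N + 1) := by
      rw [← pow_mul, mul_pow]
      have h4 : x ^ (N * (N + 1)) = x ^ ((N + 1) * (N + 1 - 1)) := by
        rw [Nat.add_sub_cancel, mul_comm]
      rw [h4]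
      refine h1.trans ?_
      push_cast at h2
      gcongr
    exact le_of_pow_le_pow_left₀ (Nat.succ_ne_zero N) (by positivity) h3
  have hlim := tendsto_pow_const_div_const_pow_of_one_lt 1 hx1
  have hlim0 := tendsto_pow_const_div_const_pow_of_one_lt 0 hx1
  have hl : Filter.Tendsto (fun N : ℕ => ((N : ℝ) ^ 1 / x ^ N + (N : ℝ) ^ 0 / x ^ N) * M)
      Filter.atTop (nhds ((0 + 0) * M)) := (hlim.add hlim0).mul_const M
  have : (1 : ℝ) ≤ (0 + 0) * M := by
    refine ge_of_tendsto' hl fun N => ?_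
    have hp : 0 < x ^ N := by positivity
    rw [← add_div, div_mul_eq_mul_div, le_div_iff₀ hp]
    simpa using key N
  norm_num at this

/-- **Bieberbach–Eilenberg functions** `F` have `|F' 0| ≤ 1`. -/
theorem norm_deriv_le_one_of_mul_ne_one {F : ℂ → ℂ} (hF : DifferentiableOn ℂ F (ball 0 1))
    (h0 : F 0 = 0) (hne : ∀ z ∈ ball (0 : ℂ) 1, ∀ ζ ∈ ball (0 : ℂ) 1, F z * F ζ ≠ 1) :
    ‖deriv F 0‖ ≤ 1 := by
  have h : ∀ r ∈ Ioo (0 : ℝ) 1, r * ‖deriv F 0‖ ≤ 1 := fun r hr => by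
    obtain ⟨M, hM⟩ := pow_le_of_mul_ne_one hF h0 hne hr.1 hr.2
    exact le_one_of_prod_pow_le hM
  have hc : Filter.Tendsto (fun r : ℝ => r * ‖deriv F 0‖) (nhdsWithin 1 (Iio 1))
      (nhds (1 * ‖deriv F 0‖)) :=
    (tendsto_nhdsWithin_of_tendsto_nhds Filter.tendsto_id).mul_const _
  rw [one_mul] at hc
  refine le_of_tendsto hc ?_
  filter_upwards [Ioo_mem_nhdsLT (show (0 : ℝ) < 1 by norm_num)] with r hr using h r hr

/-! ### Logarithms and Koebe's quarter theorem -/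

/-- Every holomorphic function without zeros on `G` has a holomorphic logarithm. -/
def HasLogs (G : Set ℂ) : Prop :=
  ∀ f : ℂ → ℂ, DifferentiableOn ℂ f G → (∀ x ∈ G, f x ≠ 0) →
    ∃ L : ℂ → ℂ, DifferentiableOn ℂ L G ∧ ∀ x ∈ G, exp (L x) = f x

lemma HasLogs.exists_sqrt {G : Set ℂ} (hG : HasLogs G) {f : ℂ → ℂ} (hf : DifferentiableOn ℂ f G)
    (h0 : ∀ x ∈ G, f x ≠ 0) :
    ∃ S : ℂ → ℂ, DifferentiableOn ℂ S G ∧ (∀ x ∈ G, S x ^ 2 = f x) ∧ ∀ x ∈ G, S x ≠ 0 := by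
  obtain ⟨L, hL, hexp⟩ := hG f hf h0
  refine ⟨fun x => exp (L x / 2), (hL.div_const 2).cexp, fun x hx => ?_, fun x _ => exp_ne_zero _⟩
  rw [← hexp x hx, ← Complex.exp_nat_mul]
  congr 1
  push_cast
  ring

/-- **Koebe's quarter theorem** for holomorphic maps into a domain with logarithms. -/
theorem HasLogs.norm_deriv_le {G : Set ℂ} (hG : HasLogs G) {p : ℂ} (hp : p ∉ G) {g : ℂ → ℂ}
    (hg : DifferentiableOn ℂ g (ball 0 1)) (hgG : MapsTo g (ball 0 1) G) :
    ‖deriv g 0‖ ≤ 4 * ‖g 0 - p‖ := by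
  have hmem : (0 : ℂ) ∈ ball (0 : ℂ) 1 := mem_ball_self one_pos
  obtain ⟨S, hS, hsq, hS0⟩ := hG.exists_sqrt (f := fun x => x - p) (by fun_prop)
    fun x hx => sub_ne_zero.2 (ne_of_mem_of_not_mem hx hp)
  set h := fun ζ => S (g ζ) with hh
  have hd : DifferentiableOn ℂ h (ball 0 1) := hS.comp hg hgG
  have hhsq : ∀ ζ ∈ ball (0 : ℂ) 1, h ζ ^ 2 = g ζ - p := fun ζ hζ => hsq _ (hgG hζ)
  -- Opposite values of `h` have equal squares, hence come from the same value of `g`. Since `h`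
  -- factors through `g`, they coincide and vanish. Injectivity of `g` is not needed.
  have hne : ∀ z ∈ ball (0 : ℂ) 1, ∀ ζ ∈ ball (0 : ℂ) 1, h z + h ζ ≠ 0 := by
    intro z hz ζ hζ hs
    have e : h z = - h ζ := eq_neg_of_add_eq_zero_left hs
    have e2 : g z = g ζ := by
      have h1 := hhsq z hz
      have h2 := hhsq ζ hζ
      rw [e] at h1
      linear_combination h2 - h1
    have e3 : h z = h ζ := by simp only [hh, e2]
    rw [e3] at hs
    exact hS0 _ (hgG hζ) (by linear_combination hs / 2)
  set c := h 0 with hc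
  have hc0 : c ≠ 0 := hS0 _ (hgG hmem)
  -- For this Möbius image of `h`, the product of two values equals 1 exactly when the two values of
  -- `h` add up to 0.
  have key := norm_deriv_le_one_of_mul_ne_one (F := fun ζ => (h ζ - c) / (h ζ + c))
    ((hd.sub_const c).div (hd.add_const c) fun ζ hζ => hne ζ hζ 0 hmem) (by simp [hc])
    (by
      intro z hz ζ hζ e
      have h1 := hne z hz 0 hmem
      have h2 := hne ζ hζ 0 hmem
      rw [← hc] at h1 h2
      rw [div_mul_div_comm, div_eq_one_iff_eq (mul_ne_zero h1 h2)] at e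
      have : c * (h z + h ζ) = 0 := by linear_combination -e / 2
      rcases mul_eq_zero.1 this with h3 | h3
      · exact hc0 h3
      · exact hne z hz ζ hζ h3)
  have hda : HasDerivAt h (deriv h 0) 0 :=
    (hd.differentiableAt (isOpen_ball.mem_nhds hmem)).hasDerivAt
  have hga : HasDerivAt g (deriv g 0) 0 :=
    (hg.differentiableAt (isOpen_ball.mem_nhds hmem)).hasDerivAt
  have e1 : deriv g 0 = 2 * c * deriv h 0 := by
    have h1 : HasDerivAt (fun ζ => h ζ ^ 2) (2 * c * deriv h 0) 0 := by
      simpa [hc] using hda.fun_pow 2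
    have h2 : HasDerivAt (fun ζ => g ζ - p) (deriv g 0) 0 := hga.sub_const p
    refine h2.unique (h1.congr_of_eventuallyEq ?_)
    filter_upwards [isOpen_ball.mem_nhds hmem] with ζ hζ using (hhsq ζ hζ).symm
  have e2 : deriv (fun ζ => (h ζ - c) / (h ζ + c)) 0 = deriv h 0 / (2 * c) := by
    have := (hda.sub_const c).fun_div (hda.add_const c) (hne 0 hmem 0 hmem)
    rw [this.deriv, ← hc]
    field_simp
    ring
  have e3 : g 0 - p = c ^ 2 := (hhsq 0 hmem).symm
  have e4 : deriv g 0 = 4 * c ^ 2 * (deriv h 0 / (2 * c)) := by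
    rw [e1]; field_simp; ring
  rw [e2] at key
  rw [e3, e4, norm_mul, norm_mul, Complex.norm_ofNat]
  exact mul_le_of_le_one_right (by positivity) key

/-! ### Disc automorphisms and nearly surjective disc charts -/

/-- The involutive automorphism of the unit disc which exchanges `0` and `α`. -/
noncomputable def discInvolution (α u : ℂ) : ℂ := (α - u) / (1 - (starRingEnd ℂ) α * u)

lemma one_sub_conj_mul_ne_zero {α u : ℂ} (hα : ‖α‖ < 1) (hu : ‖u‖ < 1) :
    1 - (starRingEnd ℂ) α * u ≠ 0 := by
  intro h
  have h1 : ‖(starRingEnd ℂ) α * u‖ = 1 := by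
    rw [← sub_eq_zero.1 h, norm_one]
  rw [norm_mul, norm_conj] at h1
  nlinarith [norm_nonneg α, norm_nonneg u]

lemma norm_discInvolution_lt_one {α u : ℂ} (hα : ‖α‖ < 1) (hu : ‖u‖ < 1) :
    ‖discInvolution α u‖ < 1 := by
  have h := norm_pos_iff.2 (one_sub_conj_mul_ne_zero hα hu)
  rw [discInvolution, norm_div, div_lt_one h]
  refine lt_of_pow_lt_pow_left₀ 2 h.le ?_
  have h1 : ‖α‖ ^ 2 < 1 := by nlinarith [norm_nonneg α]
  have h2 : ‖u‖ ^ 2 < 1 := by nlinarith [norm_nonneg u]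
  rw [← normSq_eq_norm_sq, ← normSq_eq_norm_sq] at *
  rw [normSq_apply] at *
  rw [normSq_apply] at *
  simp only [sub_re, sub_im, one_re, one_im, mul_re, mul_im, conj_re, conj_im]
  nlinarith [mul_pos (sub_pos.2 h1) (sub_pos.2 h2)]

lemma discInvolution_discInvolution {α u : ℂ} (hα : ‖α‖ < 1) (hu : ‖u‖ < 1) :
    discInvolution α (discInvolution α u) = u := by
  have h := one_sub_conj_mul_ne_zero hα hu
  have h2 := one_sub_conj_mul_ne_zero hα (norm_discInvolution_lt_one hα hu)
  simp only [discInvolution] at *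
  rw [div_eq_iff h2]
  linear_combination -div_mul_cancel₀ (α - u) h

@[simp] lemma discInvolution_zero (α : ℂ) : discInvolution α 0 = α := by simp [discInvolution]

@[simp] lemma discInvolution_self (α : ℂ) : discInvolution α α = 0 := by simp [discInvolution]

lemma hasDerivAt_discInvolution {α u : ℂ} (hα : ‖α‖ < 1) (hu : ‖u‖ < 1) :
    HasDerivAt (discInvolution α)
      (-(1 - (starRingEnd ℂ) α * α) / (1 - (starRingEnd ℂ) α * u) ^ 2) u := by
  have h := ((hasDerivAt_id u).const_sub α).fun_div
    (((hasDerivAt_id u).const_mul ((starRingEnd ℂ) α)).const_sub 1)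
    (one_sub_conj_mul_ne_zero hα hu)
  refine h.congr_deriv ?_
  simp only [id]
  ring

lemma differentiableOn_discInvolution {α : ℂ} (hα : ‖α‖ < 1) :
    DifferentiableOn ℂ (discInvolution α) (ball 0 1) := fun _ hu =>
  (hasDerivAt_discInvolution hα (mem_ball_zero_iff.1 hu)).differentiableAt.differentiableWithinAt

lemma mapsTo_discInvolution {α : ℂ} (hα : ‖α‖ < 1) :
    MapsTo (discInvolution α) (ball 0 1) (ball 0 1) := fun _ hu =>
  mem_ball_zero_iff.2 (norm_discInvolution_lt_one hα (mem_ball_zero_iff.1 hu))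

lemma discInvolution_eq_zero {α u : ℂ} (hα : ‖α‖ < 1) (hu : ‖u‖ < 1)
    (h : discInvolution α u = 0) : u = α := by
  have := discInvolution_discInvolution hα hu
  rw [h, discInvolution_zero] at this
  exact this.symm

/-- `φ` embeds `G` holomorphically in the unit disc, sends `z₀` to `0` and has the holomorphic
left inverse `ψ`. -/
structure IsDiscEmbedding (G : Set ℂ) (z₀ : ℂ) (φ ψ : ℂ → ℂ) : Prop where
  differentiableOn : DifferentiableOn ℂ φ G
  mapsTo : MapsTo φ G (ball 0 1)
  map_base : φ z₀ = 0
  differentiableOn_inv : DifferentiableOn ℂ ψ (φ '' G)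
  left_inv : ∀ x ∈ G, ψ (φ x) = x

/-- A domain with logarithms which omits a point embeds in the unit disc. -/
lemma HasLogs.exists_isDiscEmbedding {G : Set ℂ} (hGo : IsOpen G) (hG : HasLogs G) {p : ℂ}
    (hp : p ∉ G) {z₀ : ℂ} (hz : z₀ ∈ G) :
    ∃ φ ψ : ℂ → ℂ, IsDiscEmbedding G z₀ φ ψ ∧ deriv φ z₀ ≠ 0 := by
  obtain ⟨S, hS, hsq, hS0⟩ := hG.exists_sqrt (f := fun x => x - p) (by fun_prop)
    fun x hx => sub_ne_zero.2 (ne_of_mem_of_not_mem hx hp)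
  set c := S z₀ with hc
  have hc0 : c ≠ 0 := hS0 z₀ hz
  have hSat : HasDerivAt S (deriv S z₀) z₀ :=
    (hS.differentiableAt (hGo.mem_nhds hz)).hasDerivAt
  -- The branch `S` stays away from `-c`: if `S x` is near `-c`, then `x = S x ^ 2 + p` is near
  -- `z₀`, so `S x` is also near `c`. Hence `(S + c)⁻¹` is bounded.
  obtain ⟨ε, hε, hdist⟩ : ∃ ε > 0, ∀ x ∈ G, ε < ‖S x + c‖ := by
    have hcp : 0 < ‖c‖ := norm_pos_iff.2 hc0
    obtain ⟨δ, hδ, hδS⟩ := Metric.continuousAt_iff.1 hSat.continuousAt ‖c‖ hcp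
    obtain ⟨δ', hδ', hδS'⟩ := Metric.continuousAt_iff.1
      (show ContinuousAt (fun u : ℂ => u ^ 2 + p) (-c) by fun_prop) δ hδ
    have hz0 : (-c) ^ 2 + p = z₀ := by rw [neg_sq, hc, hsq z₀ hz]; ring
    refine ⟨min (δ' / 2) (‖c‖ / 2), by positivity, fun x hx => ?_⟩
    by_contra! hle
    have h1 : dist (S x) (-c) < δ' := by
      rw [dist_eq_norm, sub_neg_eq_add]
      linarith [min_le_left (δ' / 2) (‖c‖ / 2)]
    have h2 := hδS' h1
    rw [hz0, hsq x hx, sub_add_cancel] at h2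
    have h3 := hδS h2
    rw [dist_eq_norm] at h3
    have h4 : ‖2 * c‖ ≤ ‖S x + c‖ + ‖S x - S z₀‖ := by
      have : 2 * c = (S x + c) - (S x - S z₀) := by rw [hc]; ring
      rw [this]
      exact norm_sub_le _ _
    rw [norm_mul, Complex.norm_ofNat] at h4
    linarith [min_le_right (δ' / 2) (‖c‖ / 2)]
  have hne : ∀ x ∈ G, S x + c ≠ 0 := fun x hx => norm_pos_iff.1 (hε.trans (hdist x hx))
  have h2c : (2 : ℂ) * c ≠ 0 := mul_ne_zero two_ne_zero hc0
  have hεC : (ε : ℂ) ≠ 0 := by exact_mod_cast hε.ne'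
  refine ⟨fun x => (ε / 2) * ((S x + c)⁻¹ - (2 * c)⁻¹),
    fun u => ((2 / ε * u + (2 * c)⁻¹)⁻¹ - c) ^ 2 + p, ⟨?_, ?_, ?_, ?_, ?_⟩, ?_⟩
  · exact (((hS.add_const c).inv hne).sub_const _).const_mul _
  · intro x hx
    have h1 : ∀ y ∈ G, ‖(S y + c)⁻¹‖ < ε⁻¹ := fun y hy => by
      rw [norm_inv]
      exact inv_strictAnti₀ hε (hdist y hy)
    have h2 := h1 z₀ hz
    rw [← hc, ← two_mul] at h2
    rw [mem_ball_zero_iff, norm_mul]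
    have h3 : ‖(ε / 2 : ℂ)‖ = ε / 2 := by
      rw [norm_div, norm_real, Real.norm_of_nonneg hε.le, Complex.norm_ofNat]
    rw [h3]
    calc ε / 2 * ‖(S x + c)⁻¹ - (2 * c)⁻¹‖ < ε / 2 * (ε⁻¹ + ε⁻¹) := by
          gcongr
          exact (norm_sub_le _ _).trans_lt (add_lt_add (h1 x hx) h2)
      _ = 1 := by field_simp; norm_num
  · simp only [← hc]
    rw [← two_mul, sub_self, mul_zero]
  · rintro _ ⟨x, hx, rfl⟩
    have : (2 / ε * ((ε / 2) * ((S x + c)⁻¹ - (2 * c)⁻¹)) + (2 * c)⁻¹ : ℂ) ≠ 0 := by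
      have e : (2 / ε * ((ε / 2) * ((S x + c)⁻¹ - (2 * c)⁻¹)) + (2 * c)⁻¹ : ℂ) = (S x + c)⁻¹ := by
        field_simp
        ring
      rw [e]
      exact inv_ne_zero (hne x hx)
    refine DifferentiableAt.differentiableWithinAt ?_
    have hd : DifferentiableAt ℂ (fun u : ℂ => 2 / (ε : ℂ) * u + (2 * c)⁻¹)
      ((ε / 2) * ((S x + c)⁻¹ - (2 * c)⁻¹)) := by fun_prop
    exact (((hd.fun_inv this).sub_const c).fun_pow 2).add_const p
  · intro x hx
    have e : (2 / ε * ((ε / 2) * ((S x + c)⁻¹ - (2 * c)⁻¹)) + (2 * c)⁻¹ : ℂ) = (S x + c)⁻¹ := by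
        field_simp
        ring
    rw [e, inv_inv, add_sub_cancel_right, hsq x hx, sub_add_cancel]
  · have hS' : deriv S z₀ ≠ 0 := by
      intro h0
      have h1 : HasDerivAt (fun x => S x ^ 2) 0 z₀ := by
        simpa [h0] using hSat.fun_pow 2
      have h2 : HasDerivAt (fun x => x - p) 1 z₀ := (hasDerivAt_id z₀).sub_const p
      refine one_ne_zero (h2.unique (h1.congr_of_eventuallyEq ?_))
      filter_upwards [hGo.mem_nhds hz] with x hx using (hsq x hx).symm
    have := (((hSat.add_const c).fun_inv (hne z₀ hz)).sub_const (2 * c)⁻¹).const_mul (ε / 2 : ℂ)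
    rw [this.deriv]
    have h2 := hne z₀ hz
    simp [hS', hεC, h2]

/-- The square root trick: an embedding that omits a point of the disc can be improved. -/
lemma HasLogs.exists_isDiscEmbedding_improving {G : Set ℂ} (hGo : IsOpen G) (hG : HasLogs G)
    {z₀ : ℂ} (hz : z₀ ∈ G) {φ ψ : ℂ → ℂ} (h : IsDiscEmbedding G z₀ φ ψ) {α : ℂ} (hα : ‖α‖ < 1)
    (hαφ : α ∉ φ '' G) :
    ∃ φ₁ ψ₁ : ℂ → ℂ, IsDiscEmbedding G z₀ φ₁ ψ₁ ∧
      ‖deriv φ z₀‖ * (1 + ‖α‖) = 2 * √‖α‖ * ‖deriv φ₁ z₀‖ := by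
  have hφ1 : ∀ x ∈ G, ‖φ x‖ < 1 := fun x hx => mem_ball_zero_iff.1 (h.mapsTo hx)
  obtain ⟨S, hS, hsq, hS0⟩ := hG.exists_sqrt (f := fun x => discInvolution α (φ x))
    ((differentiableOn_discInvolution hα).comp h.differentiableOn h.mapsTo)
    fun x hx h0 => hαφ ⟨x, hx, discInvolution_eq_zero hα (hφ1 x hx) h0⟩
  have hS1 : ∀ x ∈ G, ‖S x‖ < 1 := fun x hx => by
    have h1 := norm_discInvolution_lt_one hα (hφ1 x hx)
    rw [← hsq x hx, norm_pow] at h1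
    exact (pow_lt_one_iff_of_nonneg (norm_nonneg _) two_ne_zero).1 h1
  set s := S z₀ with hs
  have hs1 : ‖s‖ < 1 := hS1 z₀ hz
  have hs2 : s ^ 2 = α := by
    have := hsq z₀ hz
    rwa [h.map_base, discInvolution_zero] at this
  have hsα : ‖α‖ = ‖s‖ ^ 2 := by rw [← hs2, norm_pow]
  -- `Q` is a self-map of the disc with `φ = Q ∘ φ₁` on `G`; the asserted identity expresses that
  -- `|Q'(0)| = 2√‖α‖ / (1 + ‖α‖)`.
  set Q : ℂ → ℂ := fun u => discInvolution α (discInvolution s u ^ 2) with hQ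
  set φ₁ : ℂ → ℂ := fun x => discInvolution s (S x) with hφ₁
  have hQφ : ∀ x ∈ G, Q (φ₁ x) = φ x := fun x hx => by
    simp only [hQ, hφ₁]
    rw [discInvolution_discInvolution hs1 (hS1 x hx), hsq x hx,
      discInvolution_discInvolution hα (hφ1 x hx)]
  have hsqm : MapsTo (fun u : ℂ => u ^ 2) (ball 0 1) (ball 0 1) := fun u hu => by
    rw [mem_ball_zero_iff] at *
    rw [norm_pow]
    exact pow_lt_one₀ (norm_nonneg _) hu two_ne_zero
  have hQd : DifferentiableOn ℂ Q (ball 0 1) :=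
    (differentiableOn_discInvolution hα).comp ((differentiableOn_discInvolution hs1).fun_pow 2)
      (hsqm.comp (mapsTo_discInvolution hs1))
  have hφ₁d : DifferentiableOn ℂ φ₁ G := (differentiableOn_discInvolution hs1).comp hS
    fun x hx => mem_ball_zero_iff.2 (hS1 x hx)
  have hφ₁m : MapsTo φ₁ G (ball 0 1) := fun x hx =>
    mapsTo_discInvolution hs1 (mem_ball_zero_iff.2 (hS1 x hx))
  have hφ₁0 : φ₁ z₀ = 0 := by simp only [hφ₁, ← hs, discInvolution_self]
  refine ⟨φ₁, fun u => ψ (Q u), ⟨hφ₁d, hφ₁m, hφ₁0, ?_, ?_⟩, ?_⟩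
  · refine h.differentiableOn_inv.comp (hQd.mono (image_subset_iff.2 hφ₁m)) ?_
    rintro _ ⟨x, hx, rfl⟩
    exact ⟨x, hx, (hQφ x hx).symm⟩
  · intro x hx
    simp only [hQφ x hx, h.left_inv x hx]
  · have hm := hGo.mem_nhds hz
    have hd1 : HasDerivAt φ₁ (deriv φ₁ z₀) z₀ := (hφ₁d.differentiableAt hm).hasDerivAt
    have hQ1 : HasDerivAt Q (-(1 - (starRingEnd ℂ) α * α) / (1 - (starRingEnd ℂ) α * α) ^ 2 *
        (2 * s * (-(1 - (starRingEnd ℂ) s * s)))) (φ₁ z₀) := by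
      rw [hφ₁0]
      have e1 : HasDerivAt (fun u => discInvolution s u ^ 2)
          (2 * s * (-(1 - (starRingEnd ℂ) s * s))) 0 := by
        simpa using (hasDerivAt_discInvolution hs1 (u := 0) (by simp)).fun_pow 2
      have e2 := hasDerivAt_discInvolution hα hα
      refine HasDerivAt.comp (h₂ := discInvolution α) (0 : ℂ) ?_ e1
      simpa [hs2] using e2
    have hc := hQ1.comp z₀ hd1
    have hd : HasDerivAt φ _ z₀ := hc.congr_of_eventuallyEq (by
      filter_upwards [hm] with x hx using (hQφ x hx).symm)
    rw [hd.deriv]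
    have hsq' : √‖α‖ = ‖s‖ := by rw [hsα, Real.sqrt_sq (norm_nonneg _)]
    have e : ∀ a : ℂ, ‖a‖ < 1 → ‖1 - (starRingEnd ℂ) a * a‖ = 1 - ‖a‖ ^ 2 := fun a ha => by
      have : 1 - (starRingEnd ℂ) a * a = ((1 - ‖a‖ ^ 2 : ℝ) : ℂ) := by
        rw [mul_comm, mul_conj, normSq_eq_norm_sq]; push_cast; ring
      rw [this, norm_real, Real.norm_of_nonneg]
      nlinarith [norm_nonneg a]
    rw [hsq']
    simp only [norm_mul, norm_div, norm_neg, norm_pow, e α hα, e s hs1, Complex.norm_ofNat]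
    have h1 : 0 < 1 - ‖s‖ ^ 2 := by nlinarith [norm_nonneg s]
    have h2 : 1 - (‖s‖ ^ 2) ^ 2 = (1 - ‖s‖ ^ 2) * (1 + ‖s‖ ^ 2) := by ring
    rw [hsα, h2]
    field_simp

/-- An approximate form of the **Riemann mapping theorem**. -/
theorem HasLogs.exists_disc_chart {G : Set ℂ} (hGo : IsOpen G) (hG : HasLogs G) {p : ℂ}
    (hp : p ∉ G) {z₀ : ℂ} (hz : z₀ ∈ G) {ρ : ℝ} (hρ0 : 0 < ρ) (hρ : ρ < 1) :
    ∃ φ ψ : ℂ → ℂ, DifferentiableOn ℂ φ G ∧ MapsTo φ G (ball 0 1) ∧ φ z₀ = 0 ∧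
      DifferentiableOn ℂ ψ (ball 0 ρ) ∧ MapsTo ψ (ball 0 ρ) G ∧ ∀ x ∈ G, ψ (φ x) = x := by
  set A : Set ℝ := {a | ∃ φ ψ : ℂ → ℂ, IsDiscEmbedding G z₀ φ ψ ∧ a = ‖deriv φ z₀‖} with hA
  have hbdd : BddAbove A := by
    obtain ⟨R, hR, hRG⟩ := Metric.isOpen_iff.1 hGo z₀ hz
    refine ⟨1 / R, ?_⟩
    rintro _ ⟨φ, ψ, h, rfl⟩
    refine norm_deriv_le_div_of_mapsTo_ball (h.differentiableOn.mono hRG) ?_ hR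
    rw [h.map_base]
    exact (h.mapsTo.mono_left hRG).mono_right ball_subset_closedBall
  obtain ⟨φ₀, ψ₀, h₀, hne₀⟩ := hG.exists_isDiscEmbedding hGo hp hz
  have hmem₀ : ‖deriv φ₀ z₀‖ ∈ A := ⟨φ₀, ψ₀, h₀, rfl⟩
  have hpos : 0 < sSup A := (norm_pos_iff.2 hne₀).trans_le (le_csSup hbdd hmem₀)
  set y := √ρ with hy
  have hy0 : 0 < y := Real.sqrt_pos.2 hρ0
  have hy2 : y ^ 2 = ρ := Real.sq_sqrt hρ0.le
  have hy1 : y < 1 := by nlinarith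
  have hη : 2 * y / (1 + y ^ 2) < 1 := by
    rw [div_lt_one (by positivity)]
    nlinarith [sq_pos_of_pos (sub_pos.2 hy1)]
  -- A near-extremal embedding suffices, so no compactness of families is needed. If it omitted some
  -- `α` with `‖α‖ < ρ`, the improved embedding would have derivative above the supremum, because
  -- `2x / (1 + x ^ 2)` increases on `[0, 1]`.
  obtain ⟨_, ⟨φ, ψ, h, rfl⟩, hlt⟩ := exists_lt_of_lt_csSup ⟨_, hmem₀⟩
    (mul_lt_of_lt_one_left hpos hη)
  have hcover : ball 0 ρ ⊆ φ '' G := by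
    intro α hα
    rw [mem_ball_zero_iff] at hα
    by_contra hαφ
    obtain ⟨φ₁, ψ₁, h₁, he⟩ := hG.exists_isDiscEmbedding_improving hGo hz h (hα.trans hρ) hαφ
    have hle : ‖deriv φ₁ z₀‖ ≤ sSup A := le_csSup hbdd ⟨φ₁, ψ₁, h₁, rfl⟩
    set x := √‖α‖ with hx
    have hx0 : 0 ≤ x := Real.sqrt_nonneg _
    have hx2 : x ^ 2 = ‖α‖ := Real.sq_sqrt (norm_nonneg _)
    have hxy : x ≤ y := Real.sqrt_le_sqrt hα.le
    rw [← hx2] at he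
    have h1 : ‖deriv φ z₀‖ ≤ 2 * x / (1 + x ^ 2) * sSup A := by
      rw [div_mul_eq_mul_div, le_div_iff₀ (by positivity), he]
      gcongr
    have h2 : 2 * x / (1 + x ^ 2) ≤ 2 * y / (1 + y ^ 2) := by
      rw [div_le_div_iff₀ (by positivity) (by positivity)]
      nlinarith [mul_nonneg (sub_nonneg.2 hxy) (show 0 ≤ 1 - x * y by nlinarith)]
    nlinarith
  refine ⟨φ, ψ, h.differentiableOn, h.mapsTo, h.map_base, h.differentiableOn_inv.mono hcover,
    fun u hu => ?_, h.left_inv⟩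
  obtain ⟨x, hx, rfl⟩ := hcover hu
  rwa [h.left_inv x hx]

/-! ### The Carathéodory distance of plane domains with logarithms -/

lemma hasDerivAt_real_tanh (x : ℝ) : HasDerivAt Real.tanh (1 - Real.tanh x ^ 2) x := by
  have h := (Real.hasDerivAt_sinh x).fun_div (Real.hasDerivAt_cosh x) (Real.cosh_pos x).ne'
  have e : Real.tanh = fun y => Real.sinh y / Real.cosh y := funext Real.tanh_eq_sinh_div_cosh
  rw [e]
  refine h.congr_deriv ?_
  have := (Real.cosh_pos x).ne'
  field_simp

lemma continuousAt_artanh {x : ℝ} (hx : x ∈ Ioo (-1 : ℝ) 1) : ContinuousAt Real.artanh x := by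
  have h1 : 0 < 1 + x := by linarith [hx.1]
  have h2 : 0 < 1 - x := by linarith [hx.2]
  have h3 : √((1 + x) / (1 - x)) ≠ 0 := (Real.sqrt_pos.2 (div_pos h1 h2)).ne'
  have h4 : ContinuousAt (fun y : ℝ => √((1 + y) / (1 - y))) x :=
    Real.continuous_sqrt.continuousAt.comp
      (ContinuousAt.div (by fun_prop) (by fun_prop) h2.ne')
  exact h4.log h3

/-- A holomorphic function bounds the Carathéodory distance from below. -/
lemma artanh_le_caratheodoryDist {E : Type*} [NormedAddCommGroup E] [NormedSpace ℂ E] {D : Set E}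
    {z w : E} {f : E → ℂ} (hf : DifferentiableOn ℂ f D) (hfD : MapsTo f D (ball 0 1))
    (hfz : f z = 0) : ((Real.artanh ‖f w‖ : ℝ) : EReal) ≤ caratheodoryDist D z w :=
  le_sSup ⟨f, hf, hfD, hfz, rfl⟩

/-- Holomorphic maps decrease the Carathéodory distance. -/
lemma caratheodoryDist_le_of_mapsTo {E F : Type*} [NormedAddCommGroup E] [NormedSpace ℂ E]
    [NormedAddCommGroup F] [NormedSpace ℂ F] {D : Set E} {G : Set F} {π : E → F}
    (hπ : DifferentiableOn ℂ π D) (hπD : MapsTo π D G) (z w : E) :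
    caratheodoryDist G (π z) (π w) ≤ caratheodoryDist D z w := by
  refine sSup_le ?_
  rintro _ ⟨f, hf, hfG, hfz, rfl⟩
  exact artanh_le_caratheodoryDist (f := f ∘ π) (hf.comp hπ hπD) (hfG.comp hπD) hfz

/-- Precomposing with the involution exchanging 0 and `u` moves Koebe's theorem from 0 to `u`; the
factor `1 - ‖u‖ ^ 2` is the derivative of the involution at 0 in modulus. -/
lemma HasLogs.norm_deriv_mul_le {G : Set ℂ} (hG : HasLogs G) {p : ℂ} (hp : p ∉ G) {g : ℂ → ℂ}
    (hg : DifferentiableOn ℂ g (ball 0 1)) (hgG : MapsTo g (ball 0 1) G) {u : ℂ} (hu : ‖u‖ < 1) :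
    ‖deriv g u‖ * (1 - ‖u‖ ^ 2) ≤ 4 * ‖g u - p‖ := by
  have h := hG.norm_deriv_le hp (hg.comp (differentiableOn_discInvolution hu)
    (mapsTo_discInvolution hu)) (hgG.comp (mapsTo_discInvolution hu))
  have h1 := hasDerivAt_discInvolution hu (u := 0) (by simp)
  have h2 : HasDerivAt g (deriv g u) (discInvolution u 0) := by
    rw [discInvolution_zero]
    exact (hg.differentiableAt (isOpen_ball.mem_nhds (mem_ball_zero_iff.2 hu))).hasDerivAt
  rw [(h2.comp (0 : ℂ) h1).deriv] at h
  have e : 1 - (starRingEnd ℂ) u * u = ((1 - ‖u‖ ^ 2 : ℝ) : ℂ) := by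
    rw [mul_comm, mul_conj, normSq_eq_norm_sq]; push_cast; ring
  have hpos : 0 ≤ 1 - ‖u‖ ^ 2 := by nlinarith [norm_nonneg u]
  simpa [e, -ofReal_sub, -ofReal_pow, -ofReal_one, norm_real, abs_of_nonneg hpos] using h

/-- The growth theorem for holomorphic maps of the disc into a domain with logarithms. -/
theorem HasLogs.norm_sub_le_of_mapsTo {G : Set ℂ} (hG : HasLogs G) {p : ℂ} (hp : p ∉ G)
    {g : ℂ → ℂ} (hg : DifferentiableOn ℂ g (ball 0 1)) (hgG : MapsTo g (ball 0 1) G) {ζ : ℂ}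
    (hζ : ‖ζ‖ < 1) :
    ‖g 0 - g ζ‖ ≤ ‖g ζ - p‖ * (Real.exp (4 * Real.artanh ‖ζ‖) - 1) := by
  rcases eq_or_ne ζ 0 with rfl | hζ0
  · simp
  have hn : ‖ζ‖ ≠ 0 := norm_ne_zero_iff.2 hζ0
  set e : ℂ := ζ / ‖ζ‖ with he
  have hne : ‖e‖ = 1 := by rw [he, norm_div, norm_real, norm_norm, div_self hn]
  set R := Real.artanh ‖ζ‖ with hR
  have hR0 : 0 ≤ R := Real.artanh_nonneg (norm_nonneg _)
  have htR : Real.tanh R = ‖ζ‖ := Real.tanh_artanh ⟨by linarith [norm_nonneg ζ], hζ⟩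
  -- The geodesic from `ζ` to 0, parametrised so that its speed is `1 - ‖c‖ ^ 2`, which cancels the
  -- weight in the Koebe estimate. Starting at `ζ` puts `‖g ζ - p‖` into the final bound.
  set c : ℝ → ℂ := fun s => (Real.tanh (R - s) : ℂ) * e with hc
  have hcn : ∀ s, ‖c s‖ = |Real.tanh (R - s)| := fun s => by
    rw [hc, norm_mul, hne, mul_one, norm_real, Real.norm_eq_abs]
  have hc1 : ∀ s, ‖c s‖ < 1 := fun s => by
    rw [hcn, abs_lt]
    exact ⟨Real.neg_one_lt_tanh _, Real.tanh_lt_one _⟩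
  have hcd : ∀ s, HasDerivAt c (((-(1 - Real.tanh (R - s) ^ 2) : ℝ) : ℂ) * e) s := fun s => by
    have h1 : HasDerivAt (fun s => Real.tanh (R - s)) (-(1 - Real.tanh (R - s) ^ 2)) s := by
      exact ((hasDerivAt_real_tanh (R - s)).comp s ((hasDerivAt_id s).const_sub R)).congr_deriv
        (by ring)
    exact h1.ofReal_comp.mul_const e
  have hgd : ∀ s, HasDerivAt (fun s => g (c s) - g ζ)
      ((((-(1 - Real.tanh (R - s) ^ 2) : ℝ) : ℂ) * e) • deriv g (c s)) s := fun s => by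
    have h2 : HasDerivAt g (deriv g (c s)) (c s) :=
      (hg.differentiableAt (isOpen_ball.mem_nhds (mem_ball_zero_iff.2 (hc1 s)))).hasDerivAt
    exact (h2.scomp s (hcd s)).sub_const _
  have hbound : ∀ s ∈ Ico 0 R, ‖(((-(1 - Real.tanh (R - s) ^ 2) : ℝ) : ℂ) * e) • deriv g (c s)‖ ≤
      4 * ‖g (c s) - g ζ‖ + 4 * ‖g ζ - p‖ := fun s _ => by
    have h3 := hG.norm_deriv_mul_le hp hg hgG (hc1 s)
    have h4 : 0 ≤ 1 - Real.tanh (R - s) ^ 2 := by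
      have := hc1 s
      rw [hcn] at this
      nlinarith [sq_abs (Real.tanh (R - s)), abs_nonneg (Real.tanh (R - s))]
    rw [hcn, sq_abs] at h3
    rw [norm_smul, norm_mul, hne, mul_one, norm_real, norm_neg, Real.norm_of_nonneg h4, mul_comm]
    refine h3.trans ?_
    have : g (c s) - p = (g (c s) - g ζ) + (g ζ - p) := by ring
    rw [this, ← mul_add]
    gcongr
    exact norm_add_le _ _
  have h0 : c 0 = ζ := by
    simp only [hc, sub_zero, htR, he]
    rw [mul_div_cancel₀]
    exact_mod_cast hn
  have hRc : c R = 0 := by simp [hc]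
  have key := norm_le_gronwallBound_of_norm_deriv_right_le (δ := 0) (K := 4)
    (ε := 4 * ‖g ζ - p‖) (a := 0) (b := R)
    (fun s _ => (hgd s).continuousAt.continuousWithinAt)
    (fun s _ => (hgd s).hasDerivWithinAt) (by simp [h0]) hbound R ⟨hR0, le_rfl⟩
  rw [hRc, gronwallBound_of_K_ne_0 (by norm_num)] at key
  refine key.trans_eq ?_
  simp

/-- The lower bound of the Carathéodory distance in a plane domain with logarithms. -/
theorem HasLogs.log_le_caratheodoryDist {G : Set ℂ} (hGo : IsOpen G) (hG : HasLogs G) {p : ℂ}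
    (hp : p ∉ G) {z w : ℂ} (hz : z ∈ G) (hw : w ∈ G) :
    ((1 / 4 * Real.log (1 + ‖z - w‖ / ‖w - p‖) : ℝ) : EReal) ≤ caratheodoryDist G z w := by
  have hd : 0 < ‖w - p‖ := norm_pos_iff.2 (sub_ne_zero.2 (ne_of_mem_of_not_mem hw hp))
  set B := 1 / 4 * Real.log (1 + ‖z - w‖ / ‖w - p‖) with hB
  have hq : 0 ≤ ‖z - w‖ / ‖w - p‖ := by positivity
  have hB0 : 0 ≤ B := mul_nonneg (by norm_num) (Real.log_nonneg (by linarith))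
  have ht0 : 0 ≤ Real.tanh B := by
    rw [Real.tanh_eq_sinh_div_cosh]
    exact div_nonneg (Real.sinh_nonneg_iff.2 hB0) (Real.cosh_pos B).le
  have ht1 := Real.tanh_lt_one B
  have key : ∀ ρ ∈ Ioo (0 : ℝ) 1,
      ((Real.artanh (ρ * Real.tanh B) : ℝ) : EReal) ≤ caratheodoryDist G z w := by
    intro ρ ⟨hρ0, hρ1⟩
    obtain ⟨φ, ψ, hφ, hφm, hφz, hψ, hψm, hinv⟩ := hG.exists_disc_chart hGo hp hz hρ0 hρ1
    refine le_trans ?_ (artanh_le_caratheodoryDist hφ hφm hφz)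
    have hφ1 : ‖φ w‖ < 1 := mem_ball_zero_iff.1 (hφm hw)
    refine EReal.coe_le_coe_iff.2 (Real.artanh_le_artanh (by nlinarith) hφ1 ?_)
    -- Only inside the ball of radius `ρ` is the inverse chart available; outside, `‖φ w‖ ≥ ρ ≥ ρ *
    -- tanh B` already.
    rcases lt_or_ge ‖φ w‖ ρ with hlt | hge
    · have hρC : (ρ : ℂ) ≠ 0 := by exact_mod_cast hρ0.ne'
      have hm : MapsTo (fun ζ : ℂ => (ρ : ℂ) * ζ) (ball 0 1) (ball 0 ρ) := fun ζ hζ => by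
        rw [mem_ball_zero_iff] at *
        rw [norm_mul, norm_real, Real.norm_of_nonneg hρ0.le]
        nlinarith
      have hnζ : ‖φ w / ρ‖ = ‖φ w‖ / ρ := by
        rw [norm_div, norm_real, Real.norm_of_nonneg hρ0.le]
      have h1 : ‖φ w‖ / ρ < 1 := (div_lt_one hρ0).2 hlt
      have h := hG.norm_sub_le_of_mapsTo hp (g := fun ζ => ψ (ρ * ζ))
        (hψ.comp (by fun_prop) hm) (hψm.comp hm) (ζ := φ w / ρ) (by rwa [hnζ])
      simp only [mul_zero, mul_div_cancel₀ _ hρC, hinv w hw, hnζ] at h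
      rw [← hφz, hinv z hz] at h
      have h2 : B ≤ Real.artanh (‖φ w‖ / ρ) := by
        rw [hB, one_div, inv_mul_le_iff₀ (by norm_num), Real.log_le_iff_le_exp (by linarith),
          ← le_sub_iff_add_le', div_le_iff₀ hd, mul_comm]
        exact h
      have hI : ‖φ w‖ / ρ ∈ Ioo (-1 : ℝ) 1 :=
        ⟨by linarith [div_nonneg (norm_nonneg (φ w)) hρ0.le], h1⟩
      rw [← Real.artanh_tanh B, Real.artanh_le_artanh_iff ⟨Real.neg_one_lt_tanh B, ht1⟩ hI,
        le_div_iff₀ hρ0] at h2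
      linarith
    · nlinarith
  have hlim : Filter.Tendsto (fun ρ : ℝ => ((Real.artanh (ρ * Real.tanh B) : ℝ) : EReal))
      (nhdsWithin 1 (Iio 1)) (nhds ((B : ℝ) : EReal)) := by
    refine (continuous_coe_real_ereal.tendsto B).comp ?_
    have h1 : Filter.Tendsto (fun ρ : ℝ => ρ * Real.tanh B) (nhdsWithin 1 (Iio 1))
        (nhds (1 * Real.tanh B)) :=
      (tendsto_nhdsWithin_of_tendsto_nhds Filter.tendsto_id).mul_const _
    rw [one_mul] at h1
    have h2 := (continuousAt_artanh ⟨Real.neg_one_lt_tanh B, ht1⟩).tendsto.comp h1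
    rwa [Real.artanh_tanh] at h2
  refine le_of_tendsto hlim ?_
  filter_upwards [Ioo_mem_nhdsLT (show (0 : ℝ) < 1 by norm_num)] with ρ hρ using key ρ hρ

/-! ### Continuity of families of logarithms -/

lemma eq_of_exp_eq_of_norm_sub_lt {a b : ℂ} (h : exp a = exp b) (hd : ‖a - b‖ < 2 * Real.pi) :
    a = b := by
  obtain ⟨n, hn⟩ := exp_eq_exp_iff_exists_int.1 h
  have h1 : a - b = n * (2 * Real.pi * I) := by rw [hn]; ring
  rw [h1, norm_mul, norm_mul, norm_mul, norm_I, mul_one, norm_real, Complex.norm_ofNat,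
    Real.norm_of_nonneg Real.pi_pos.le, norm_intCast] at hd
  have h2 : |(n : ℝ)| < 1 := by
    by_contra! hc
    nlinarith [Real.pi_pos]
  have h3 : n = 0 := by
    rw [← Int.abs_lt_one_iff]
    exact_mod_cast h2
  simpa [h3] using hn

/-- A continuous logarithm of a constant on a preconnected set is constant. -/
lemma IsPreconnected.eq_of_exp_eq {X : Type*} [TopologicalSpace X] {s : Set X}
    (hs : IsPreconnected s) {h : X → ℂ} (hc : ContinuousOn h s)
    (hexp : ∀ x ∈ s, ∀ y ∈ s, exp (h x) = exp (h y)) {x y : X} (hx : x ∈ s) (hy : y ∈ s) :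
    h x = h y := by
  refine hs.induction₂ (fun x y => h x = h y) (fun x hx => ?_) (fun _ _ _ _ _ _ => Eq.trans)
    (fun _ _ _ _ => Eq.symm) hx hy
  filter_upwards [(hc x hx) (ball_mem_nhds (h x) Real.two_pi_pos), self_mem_nhdsWithin]
    with y hy hys
  refine eq_of_exp_eq_of_norm_sub_lt (hexp x hx y hys) ?_
  rw [norm_sub_rev, ← dist_eq_norm]
  exact hy

/-- A family of continuous logarithms on connected slices depends continuously on the parameter as
soon as it does so along a continuous section. -/
theorem continuousOn_of_slicewise_log {M : Type*} [TopologicalSpace M] {U : Set (M × ℂ)}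
    (hU : IsOpen U) (hconn : ∀ m, IsPreconnected {t | (m, t) ∈ U}) {g : M × ℂ → ℂ}
    (hexp : ContinuousOn (fun p => exp (g p)) U)
    (hslice : ∀ m, ContinuousOn (fun t => g (m, t)) {t | (m, t) ∈ U}) {s : M → ℂ}
    (hs : Continuous s) (hsU : ∀ m, (m, s m) ∈ U) (hgs : Continuous fun m => g (m, s m)) :
    ContinuousOn g U := by
  -- Near a point, `g` differs from a principal branch by a quantity that is constant on each slice
  -- of a small ball. Continuity along one section through the ball therefore gives continuity at
  -- all points of the ball over `m₀`.
  have hlocal : ∀ m₀ t₀, (m₀, t₀) ∈ U → ∃ B ∈ 𝓝 t₀, ∀ σ : M → ℂ, ContinuousAt σ m₀ → σ m₀ ∈ B →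
      ContinuousAt (fun m => g (m, σ m)) m₀ → ∀ t ∈ B, ContinuousAt g (m₀, t) := by
    intro m₀ t₀ h₀
    set c := g (m₀, t₀) with hc
    have hca : ContinuousAt (fun p => exp (g p) / exp c) (m₀, t₀) :=
      (hexp.continuousAt (hU.mem_nhds h₀)).div_const _
    have hnear : ∀ᶠ p in 𝓝 (m₀, t₀), p ∈ U ∧ exp (g p) / exp c ∈ slitPlane := by
      have hUm : ∀ᶠ p in 𝓝 (m₀, t₀), p ∈ U := hU.mem_nhds h₀
      refine hUm.and (hca.preimage_mem_nhds (isOpen_slitPlane.mem_nhds ?_))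
      rw [← hc, div_self (exp_ne_zero _)]
      exact one_mem_slitPlane
    rw [nhds_prod_eq] at hnear
    obtain ⟨V, hV, W, hW, hVW⟩ := eventually_prod_iff.1 hnear
    obtain ⟨r, hr, hrW⟩ := Metric.mem_nhds_iff.1 hW
    obtain ⟨V', hV'V, hV'o, hm₀⟩ := mem_nhds_iff.1 hV
    set B := ball t₀ r
    have hsub : ∀ m ∈ V', ∀ t ∈ B, (m, t) ∈ U ∧ exp (g (m, t)) / exp c ∈ slitPlane :=
      fun m hm t ht => hVW (hV'V hm) (hrW ht)
    set ℓ : M × ℂ → ℂ := fun p => log (exp (g p) / exp c) with hℓ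
    have hℓc : ContinuousOn ℓ (V' ×ˢ B) := by
      refine ContinuousOn.clog ((hexp.mono fun p hp => ?_).div_const _) fun p hp => ?_
      · exact (hsub p.1 hp.1 p.2 hp.2).1
      · exact (hsub p.1 hp.1 p.2 hp.2).2
    have hexpℓ : ∀ p, exp (g p - ℓ p) = exp c := fun p => by
      rw [exp_sub, hℓ, exp_log (div_ne_zero (exp_ne_zero _) (exp_ne_zero _))]
      field_simp [exp_ne_zero]
    have hconst : ∀ m ∈ V', ∀ t ∈ B, ∀ t' ∈ B, g (m, t) - ℓ (m, t) = g (m, t') - ℓ (m, t') := by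
      intro m hm t ht t' ht'
      refine (convex_ball t₀ r).isPreconnected.eq_of_exp_eq (h := fun t => g (m, t) - ℓ (m, t))
        (((hslice m).mono fun t ht => (hsub m hm t ht).1).sub
          (hℓc.comp (by fun_prop) fun t ht => ⟨hm, ht⟩)) (fun x _ y _ => ?_) ht ht'
      rw [hexpℓ, hexpℓ]
    refine ⟨B, ball_mem_nhds _ hr, fun σ hσ hσB hgσ t ht => ?_⟩
    have hopen : ∀ u ∈ B, V' ×ˢ B ∈ 𝓝 (m₀, u) := fun u hu =>
      (hV'o.prod isOpen_ball).mem_nhds ⟨hm₀, hu⟩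
    have hσℓ : ContinuousAt (fun m => ℓ (m, σ m)) m₀ :=
      ContinuousAt.comp (f := fun m => (m, σ m)) (hℓc.continuousAt (hopen _ hσB))
        (continuousAt_id.prodMk hσ)
    have hk : ContinuousAt (fun p : M × ℂ => ℓ p + (g (p.1, σ p.1) - ℓ (p.1, σ p.1))) (m₀, t) :=
      (hℓc.continuousAt (hopen t ht)).add
        (ContinuousAt.comp (g := fun m => g (m, σ m) - ℓ (m, σ m)) (hgσ.sub hσℓ)
          continuousAt_fst)
    refine hk.congr ?_
    have hσB' : ∀ᶠ m in 𝓝 m₀, σ m ∈ B := hσ.preimage_mem_nhds (isOpen_ball.mem_nhds hσB)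
    have hσB'' : ∀ᶠ p in 𝓝 (m₀, t), σ p.1 ∈ B := (continuous_fst.tendsto (m₀, t)).eventually hσB'
    filter_upwards [hopen t ht, hσB''] with p hp hpσ
    rw [hconst p.1 hp.1 _ hpσ p.2 hp.2]
    ring
  rintro ⟨m₀, t₀⟩ h₀
  refine ContinuousAt.continuousWithinAt ?_
  have hstart : ContinuousAt g (m₀, s m₀) := by
    obtain ⟨B, hB, h⟩ := hlocal m₀ _ (hsU m₀)
    exact h s hs.continuousAt (mem_of_mem_nhds hB) hgs.continuousAt _ (mem_of_mem_nhds hB)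
  -- Continuity at `(m₀, t)` spreads along the connected slice, locally by constant sections.
  refine ((hconn m₀).induction₂
    (fun t t' => ContinuousAt g (m₀, t) ↔ ContinuousAt g (m₀, t')) (fun t ht => ?_)
    (fun _ _ _ _ _ _ => Iff.trans) (fun _ _ _ _ => Iff.symm) (hsU m₀) h₀).1 hstart
  obtain ⟨B, hB, h⟩ := hlocal m₀ t ht
  have hmove : ∀ u ∈ B, ∀ u' ∈ B, ContinuousAt g (m₀, u) → ContinuousAt g (m₀, u') :=
    fun u hu u' hu' hgu => h (fun _ => u) continuousAt_const hu
      (ContinuousAt.comp (f := fun m => (m, u)) hgu (continuousAt_id.prodMk continuousAt_const))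
      u' hu'
  filter_upwards [mem_nhdsWithin_of_mem_nhds hB] with t' ht'
  exact ⟨hmove t (mem_of_mem_nhds hB) t' ht', hmove t' ht' t (mem_of_mem_nhds hB)⟩

/-! ### Logarithms on ℂ-convex sets and their projections -/

section CConvex

variable {E : Type*} [NormedAddCommGroup E] [NormedSpace ℂ E] {D : Set E}

lemma isEmbedding_line (a : E) {v : E} (hv : v ≠ 0) : IsEmbedding fun t : ℂ => a + t • v :=
  (Homeomorph.addLeft a).isEmbedding.comp (isClosedEmbedding_smul_left hv).isEmbedding

lemma isOpen_slice (hD : IsOpen D) (a v : E) : IsOpen {t : ℂ | a + t • v ∈ D} :=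
  hD.preimage (by fun_prop)

lemma IsCConvex.isSimplyConnected_slice (hD : IsCConvex D) {a v : E} (hv : v ≠ 0)
    (hne : ∃ t : ℂ, a + t • v ∈ D) : IsSimplyConnected {t : ℂ | a + t • v ∈ D} := by
  rw [← (isEmbedding_line a hv).isSimplyConnected_image]
  have e : (fun t : ℂ => a + t • v) '' {t : ℂ | a + t • v ∈ D} = D ∩ complexLine a v := by
    ext x
    constructor
    · rintro ⟨t, ht, rfl⟩
      exact ⟨ht, t, rfl⟩
    · rintro ⟨hx, t, rfl⟩
      exact ⟨t, hx, rfl⟩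
  rw [e]
  obtain ⟨t, ht⟩ := hne
  exact hD.2 a v hv ⟨_, ht, t, rfl⟩

lemma IsCConvex.isPreconnected_slice (hD : IsCConvex D) {a v : E} (hv : v ≠ 0) :
    IsPreconnected {t : ℂ | a + t • v ∈ D} := by
  by_cases hne : ∃ t : ℂ, a + t • v ∈ D
  · exact (hD.isSimplyConnected_slice hv hne).isPathConnected.isConnected.isPreconnected
  · rw [show {t : ℂ | a + t • v ∈ D} = ∅ from eq_empty_of_forall_notMem fun t ht => hne ⟨t, ht⟩]
    exact isPreconnected_empty

lemma IsCConvex.exists_log_slice (hD : IsCConvex D) {a v : E} (hv : v ≠ 0)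
    (hne : ∃ t : ℂ, a + t • v ∈ D) {f : ℂ → ℂ} (hf : ContinuousOn f {t : ℂ | a + t • v ∈ D})
    (h0 : ∀ t : ℂ, a + t • v ∈ D → f t ≠ 0) :
    ∃ ℓ : ℂ → ℂ, ContinuousOn ℓ {t : ℂ | a + t • v ∈ D} ∧
      ∀ t : ℂ, a + t • v ∈ D → exp (ℓ t) = f t := by
  obtain ⟨ℓ, hℓ, he⟩ := exists_continuousOn_eqOn_exp_comp (hD.isSimplyConnected_slice hv hne)
    (isOpen_slice hD.1 a v) hf (by rintro ⟨t, ht, h⟩; exact h0 t ht h)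
  exact ⟨ℓ, hℓ, fun t ht => he ht⟩

/-- A continuous function without zeros on a `ℂ`-convex set has a continuous logarithm. -/
theorem IsCConvex.exists_continuousOn_log (hD : IsCConvex D) {a : E} (ha : a ∈ D) {f : E → ℂ}
    (hf : ContinuousOn f D) (h0 : ∀ x ∈ D, f x ≠ 0) :
    ∃ L : E → ℂ, ContinuousOn L D ∧ ∀ x ∈ D, exp (L x) = f x := by
  classical
  -- Logarithms are chosen on each complex line through `a`, with the same value at `a`. The value
  -- at `t = 1` will define `L x`, and the section `t = 0` gives joint continuity.
  have hlog : ∀ x : D, ∃ ℓ : ℂ → ℂ, ContinuousOn ℓ {t : ℂ | a + t • (x.1 - a) ∈ D} ∧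
      (∀ t : ℂ, a + t • (x.1 - a) ∈ D → exp (ℓ t) = f (a + t • (x.1 - a))) ∧
      ℓ 0 = log (f a) := by
    rintro ⟨x, hx⟩
    rcases eq_or_ne x a with rfl | hxa
    · exact ⟨fun _ => log (f x), continuousOn_const, fun t _ => by simp [exp_log (h0 x hx)], rfl⟩
    · obtain ⟨ℓ, hℓ, he⟩ := hD.exists_log_slice (sub_ne_zero.2 hxa) ⟨0, by simpa using ha⟩
        (f := fun t => f (a + t • (x - a)))
        (hf.comp (by fun_prop) fun t ht => ht) fun t ht => h0 _ ht
      refine ⟨fun t => ℓ t - ℓ 0 + log (f a), (hℓ.sub continuousOn_const).add continuousOn_const, fun t ht => ?_,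
        by simp⟩
      have h00 := he 0 (by simpa using ha)
      simp only [zero_smul, add_zero] at h00
      rw [exp_add, exp_sub, he t ht, h00, exp_log (h0 a ha), div_mul_cancel₀ _ (h0 a ha)]
  choose ℓ hℓ he hℓ0 using hlog
  have hmaps : Continuous fun p : D × ℂ => a + p.2 • (p.1.1 - a) := by fun_prop
  have hcont : ContinuousOn (fun p : D × ℂ => ℓ p.1 p.2)
      {p : D × ℂ | a + p.2 • (p.1.1 - a) ∈ D} := by
    refine continuousOn_of_slicewise_log (s := fun _ => 0) (hD.1.preimage hmaps)
      (fun m => ?_) ?_ hℓ continuous_const (fun m => by simpa using ha) ?_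
    · rcases eq_or_ne m.1 a with h | h
      · have e : {t : ℂ | a + t • (m.1 - a) ∈ D} = univ := by
          ext t; simpa [h] using ha
        change IsPreconnected {t : ℂ | a + t • (m.1 - a) ∈ D}
        rw [e]
        exact isPreconnected_univ
      · exact hD.isPreconnected_slice (sub_ne_zero.2 h)
    · exact (hf.comp hmaps.continuousOn fun p hp => hp).congr fun p hp => he p.1 p.2 hp
    · simp only [hℓ0]
      exact continuous_const
  refine ⟨fun x => if h : x ∈ D then ℓ ⟨x, h⟩ 1 else 0, ?_, fun x hx => ?_⟩
  · rw [continuousOn_iff_continuous_domRestrict]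
    have h1 : Continuous fun x : D => ℓ x 1 :=
      hcont.comp_continuous (f := fun x : D => (x, (1 : ℂ))) (by fun_prop)
        fun x => by simp
    refine h1.congr fun x => ?_
    simp
  · simp only [hx, dif_pos]
    rw [he ⟨x, hx⟩ 1 (by simpa using hx)]
    simp

/-- The complex line through two points of a fibre lies in that fibre, and it meets `D` in a
connected set. -/
lemma IsCConvex.isPreconnected_fiber (hD : IsCConvex D) (π : E →L[ℂ] ℂ) (y : ℂ) :
    IsPreconnected {x | x ∈ D ∧ π x = y} := by
  refine isPreconnected_of_forall_pair fun x hx x' hx' => ?_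
  rcases eq_or_ne x' x with rfl | hne
  · exact ⟨{x'}, by simpa using hx, rfl, rfl, isPreconnected_singleton⟩
  · refine ⟨(fun t : ℂ => x + t • (x' - x)) '' {t : ℂ | x + t • (x' - x) ∈ D}, ?_,
      ⟨0, by simpa using hx.1, by simp⟩, ⟨1, by simpa using hx'.1, by simp⟩,
      (hD.isPreconnected_slice (sub_ne_zero.2 hne)).image _ (by fun_prop)⟩
    rintro _ ⟨t, ht, rfl⟩
    exact ⟨ht, by simp [hx.2, hx'.2]⟩

/-- By continuity `ℓ x - ℓ y` has imaginary part below π in modulus near `y`, so it is the principal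
logarithm of `f x / f y`. -/
lemma differentiableAt_of_exp_eventuallyEq {ℓ f : ℂ → ℂ} {y : ℂ} (hℓ : ContinuousAt ℓ y)
    (hf : DifferentiableAt ℂ f y) (h : ∀ᶠ x in 𝓝 y, exp (ℓ x) = f x) : DifferentiableAt ℂ ℓ y := by
  have hy : exp (ℓ y) = f y := h.self_of_nhds
  have hfy : f y ≠ 0 := hy ▸ exp_ne_zero _
  have hd : DifferentiableAt ℂ (fun x => log (f x / f y) + ℓ y) y := by
    refine (DifferentiableAt.clog (hf.div_const _) ?_).add_const _
    rw [div_self hfy]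
    exact one_mem_slitPlane
  refine hd.congr_of_eventuallyEq ?_
  filter_upwards [h, hℓ (ball_mem_nhds (ℓ y) Real.pi_pos)] with x hx hxy
  have him : |(ℓ x - ℓ y).im| < Real.pi :=
    (abs_im_le_norm _).trans_lt (by rw [← dist_eq_norm]; exact hxy)
  rw [← hx, ← hy, ← exp_sub, log_exp (abs_lt.1 him).1 (abs_lt.1 him).2.le, sub_add_cancel]

/-- The projection of a `ℂ`-convex set to a complex line has logarithms. -/
theorem IsCConvex.hasLogs_image (hD : IsCConvex D) {π : E →L[ℂ] ℂ} (hπ : π ≠ 0) :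
    HasLogs (π '' D) := by
  classical
  intro f hf h0
  rcases D.eq_empty_or_nonempty with rfl | ⟨a, ha⟩
  · exact ⟨0, by simp, by simp⟩
  have hopen : IsOpen (π '' D) := π.isOpenMap_of_ne_zero hπ D hD.1
  obtain ⟨L, hL, he⟩ := hD.exists_continuousOn_log ha (f := fun x => f (π x))
    (hf.continuousOn.comp π.continuous.continuousOn (mapsTo_image _ _))
    fun x hx => h0 _ (mem_image_of_mem _ hx)
  have hfib : ∀ x ∈ D, ∀ x' ∈ D, π x = π x' → L x = L x' := by
    intro x hx x' hx' hxx'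
    refine (hD.isPreconnected_fiber π (π x')).eq_of_exp_eq (hL.mono fun _ h => h.1)
      (fun u hu v hv => ?_) ⟨hx, hxx'⟩ ⟨hx', rfl⟩
    rw [he u hu.1, he v hv.1, hu.2, hv.2]
  obtain ⟨v, hv⟩ : ∃ v, π v = 1 := by
    obtain ⟨u, hu⟩ : ∃ u, π u ≠ 0 := by
      by_contra! hc
      exact hπ (ContinuousLinearMap.ext hc)
    exact ⟨(π u)⁻¹ • u, by simp [hu]⟩
  set ℓ : ℂ → ℂ := fun y => if h : ∃ x ∈ D, π x = y then L h.choose else 0 with hℓdef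
  have hℓ : ∀ x ∈ D, ℓ (π x) = L x := by
    intro x hx
    have h : ∃ x' ∈ D, π x' = π x := ⟨x, hx, rfl⟩
    simp only [hℓdef, h, dif_pos]
    exact hfib _ h.choose_spec.1 _ hx h.choose_spec.2
  have hexp : ∀ y ∈ π '' D, exp (ℓ y) = f y := by
    rintro _ ⟨x, hx, rfl⟩
    rw [hℓ x hx, he x hx]
  refine ⟨ℓ, ?_, hexp⟩
  rintro _ ⟨x, hx, rfl⟩
  have hm : π '' D ∈ 𝓝 (π x) := hopen.mem_nhds (mem_image_of_mem _ hx)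
  refine DifferentiableAt.differentiableWithinAt (differentiableAt_of_exp_eventuallyEq ?_
    (hf.differentiableAt hm) (by filter_upwards [hm] with y hy using hexp y hy))
  -- An affine local section of `π` through `x` transfers the continuity of `L` to `ℓ`.
  have hσ : ContinuousAt (fun y : ℂ => x + (y - π x) • v) (π x) := by fun_prop
  have hσx : x + (π x - π x) • v = x := by simp
  have hLσ : ContinuousAt (fun y : ℂ => L (x + (y - π x) • v)) (π x) := by
    refine ContinuousAt.comp (f := fun y : ℂ => x + (y - π x) • v) ?_ hσ
    rw [hσx]
    exact hL.continuousAt (hD.1.mem_nhds hx)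
  refine hLσ.congr ?_
  have hnear : ∀ᶠ y in 𝓝 (π x), x + (y - π x) • v ∈ D :=
    hσ.preimage_mem_nhds (by rw [hσx]; exact hD.1.mem_nhds hx)
  filter_upwards [hnear] with y hy
  rw [← hℓ _ hy]
  simp [hv]

end CConvex

/-! ### Complex tangent hyperplanes -/

section Tangent

variable {E : Type*} [NormedAddCommGroup E] [InnerProductSpace ℂ E] {D : Set E}

/-- The second point, besides `q + μ • e`, that the line through `p` and `q + μ • e` is known to
have in common with the set. -/
lemma mem_ball_of_inner_eq_zero {p q e : E} (he : e ≠ 0) (h : inner ℂ e (q - p) = 0) {μ : ℂ}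
    (hμ : μ ≠ 0) {κ : ℝ} (hκ : κ = ‖e‖ ^ 2 / (‖q - p‖ ^ 2 + ‖e‖ ^ 2 * ‖μ‖ ^ 2)) :
    p + ((κ : ℂ) * (starRingEnd ℂ) μ) • (q + μ • e - p) ∈ ball (p + e) ‖e‖ := by
  have hd : 0 < ‖e‖ := norm_pos_iff.2 he
  have hm : 0 < ‖μ‖ := norm_pos_iff.2 hμ
  set N := ‖q - p‖ ^ 2 + ‖e‖ ^ 2 * ‖μ‖ ^ 2 with hN
  have hNpos : 0 < N := by positivity
  -- This parameter gives the orthogonal projection of the centre `p + e` to the line; its squared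
  -- distance from the centre is `‖e‖ ^ 2 * ‖q - p‖ ^ 2 / N`.
  set t : ℂ := (κ : ℂ) * (starRingEnd ℂ) μ with ht
  have htμ : t * μ - 1 = ((-(‖q - p‖ ^ 2 / N) : ℝ) : ℂ) := by
    have h1 : t * μ = ((κ * ‖μ‖ ^ 2 : ℝ) : ℂ) := by
      rw [ht, mul_assoc, mul_comm ((starRingEnd ℂ) μ), mul_conj, normSq_eq_norm_sq]
      push_cast
      ring
    rw [h1, ← ofReal_one, ← ofReal_sub]
    congr 1
    rw [hκ]
    field_simp
    rw [hN]
    ring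
  have htn : ‖t‖ = κ * ‖μ‖ := by
    rw [ht, norm_mul, norm_conj, norm_real, Real.norm_of_nonneg]
    rw [hκ]
    positivity
  rw [mem_ball, dist_eq_norm]
  have e1 : p + t • (q + μ • e - p) - (p + e) = t • (q - p) + (t * μ - 1) • e := by
    module
  rw [e1]
  refine lt_of_pow_lt_pow_left₀ 2 hd.le ?_
  have horth : inner ℂ (t • (q - p)) ((t * μ - 1) • e) = 0 := by
    rw [inner_smul_left, inner_smul_right, ← inner_conj_symm, h]
    simp
  have hpyth := norm_add_sq_eq_norm_sq_add_norm_sq_of_inner_eq_zero _ _ horth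
  rw [← pow_two, ← pow_two, ← pow_two] at hpyth
  rw [hpyth, norm_smul, norm_smul, htn, htμ, norm_real, norm_neg,
    Real.norm_of_nonneg (by positivity), hκ]
  have e2 : (‖e‖ ^ 2 / N * ‖μ‖ * ‖q - p‖) ^ 2 + (‖q - p‖ ^ 2 / N * ‖e‖) ^ 2 =
      ‖e‖ ^ 2 * (‖q - p‖ ^ 2 / N) := by
    field_simp
    rw [hN]
    ring
  rw [e2]
  refine mul_lt_of_lt_one_right (by positivity) ((div_lt_one hNpos).2 ?_)
  rw [hN]
  have : 0 < ‖e‖ ^ 2 * ‖μ‖ ^ 2 := by positivity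
  linarith

/-- If a `ℂ`-convex set contains the ball with centre `w` and radius `‖w - p‖`, but not `p`, then it
does not meet the complex tangent hyperplane of this ball at `p`. -/
theorem IsCConvex.inner_ne_zero (hD : IsCConvex D) {w p q : E} (hw : w ∈ D) (hp : p ∉ D)
    (hball : ball w ‖w - p‖ ⊆ D) (hq : q ∈ D) : inner ℂ (w - p) (q - p) ≠ 0 := by
  intro horth
  set e := w - p with he
  have he0 : e ≠ 0 := sub_ne_zero.2 (ne_of_mem_of_not_mem hw hp)
  have hpe : p + e = w := by rw [he]; abel
  set M : Set ℂ := {μ | μ ≠ 0 ∧ q + μ • e ∈ D} with hM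
  set U : Set (M × ℂ) := {x | p + x.2 • (q + (x.1 : ℂ) • e - p) ∈ D} with hU
  set κ : M → ℝ := fun μ => ‖e‖ ^ 2 / (‖q - p‖ ^ 2 + ‖e‖ ^ 2 * ‖(μ : ℂ)‖ ^ 2) with hκ
  set τ : M → ℂ := fun μ => (κ μ : ℂ) * (starRingEnd ℂ) (μ : ℂ) with hτ
  have hden : ∀ μ : M, ‖q - p‖ ^ 2 + ‖e‖ ^ 2 * ‖(μ : ℂ)‖ ^ 2 ≠ 0 := fun μ => by
    have h1 := norm_pos_iff.2 he0
    have h2 := norm_pos_iff.2 μ.2.1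
    positivity
  have hτU : ∀ μ : M, (μ, τ μ) ∈ U := fun μ => hball (by
    rw [← hpe]
    exact mem_ball_of_inner_eq_zero he0 horth μ.2.1 rfl)
  have hv : ∀ μ : M, q + (μ : ℂ) • e - p ≠ 0 := fun μ =>
    sub_ne_zero.2 (ne_of_mem_of_not_mem μ.2.2 hp)
  have h1U : ∀ μ : M, (μ, (1 : ℂ)) ∈ U := fun μ => by
    simpa [hU] using μ.2.2
  -- Since `p ∉ D`, the parameter `t` has no zero on the slice of the line through `p` and `q + μ •
  -- e`, so it has a logarithm there, normalised at `t = 1`.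
  have hlog : ∀ μ : M, ∃ ℓ : ℂ → ℂ, ContinuousOn ℓ {t : ℂ | (μ, t) ∈ U} ∧
      (∀ t : ℂ, (μ, t) ∈ U → exp (ℓ t) = t) ∧ ℓ 1 = 0 := by
    intro μ
    obtain ⟨ℓ, hℓ, hexp⟩ := hD.exists_log_slice (hv μ) ⟨1, h1U μ⟩ (f := fun t => t)
      continuousOn_id (by rintro t ht rfl; simp [hp] at ht)
    refine ⟨fun t => ℓ t - ℓ 1, hℓ.sub continuousOn_const, fun t ht => ?_, sub_self _⟩
    rw [exp_sub, hexp t ht, hexp 1 (h1U μ), div_one]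
  choose ℓ hℓ hexp hℓ1 using hlog
  have hcont : ContinuousOn (fun x : M × ℂ => ℓ x.1 x.2) U := by
    refine continuousOn_of_slicewise_log (s := fun _ => 1) (hD.1.preimage (by fun_prop))
      (fun μ => hD.isPreconnected_slice (hv μ)) ?_ hℓ continuous_const h1U ?_
    · exact continuous_snd.continuousOn.congr fun x hx => hexp x.1 x.2 hx
    · simp only [hℓ1]
      exact continuous_const
  have hτc : Continuous τ := by
    have : Continuous κ := by
      refine Continuous.div (by fun_prop) (by fun_prop) hden
    simp only [hτ]
    fun_prop
  have hlift : Continuous fun μ : M => ℓ μ (τ μ) :=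
    hcont.comp_continuous (f := fun μ : M => (μ, τ μ)) (by fun_prop) hτU
  obtain ⟨r, hr, hrD⟩ : ∃ r : ℝ, 0 < r ∧ ∀ μ : ℂ, ‖μ‖ = r → q + μ • e ∈ D := by
    have hc : ContinuousAt (fun μ : ℂ => q + μ • e) 0 := by fun_prop
    have hD0 : D ∈ 𝓝 (q + (0 : ℂ) • e) := by simpa using hD.1.mem_nhds hq
    obtain ⟨ε, hε, h⟩ := Metric.mem_nhds_iff.1 (hc.preimage_mem_nhds hD0)
    refine ⟨ε / 2, by positivity, fun μ hμ => h ?_⟩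
    rw [mem_ball_zero_iff, hμ]
    linarith
  have hnorm : ∀ θ : ℝ, ‖(r : ℂ) * exp (θ * I)‖ = r := fun θ => by
    rw [norm_mul, norm_exp_ofReal_mul_I, mul_one, norm_real, Real.norm_of_nonneg hr.le]
  set μ : ℝ → M := fun θ => ⟨(r : ℂ) * exp (θ * I),
    norm_ne_zero_iff.1 (by rw [hnorm]; exact hr.ne'), hrD _ (hnorm θ)⟩ with hμ
  have hμc : Continuous μ := by
    refine Continuous.subtype_mk ?_ _
    fun_prop
  have hκμ : ∀ θ, κ (μ θ) = ‖e‖ ^ 2 / (‖q - p‖ ^ 2 + ‖e‖ ^ 2 * r ^ 2) := fun θ => by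
    simp only [hκ, hμ, hnorm]
  -- On the circle `‖μ‖ = r` the value `τ μ` is a positive multiple of `exp (-θ * I)`. Its
  -- continuous logarithm plus `θ * I` is thus constant, yet the logarithm depends on `μ` alone and
  -- returns to its value after a full turn.
  have hconst : ∀ θ : ℝ, exp (ℓ (μ θ) (τ (μ θ)) + θ * I) =
      (‖e‖ ^ 2 / (‖q - p‖ ^ 2 + ‖e‖ ^ 2 * r ^ 2) : ℝ) * r := fun θ => by
    rw [exp_add, hexp _ _ (hτU _)]
    simp only [hτ]
    rw [hκμ, mul_assoc]
    congr 1
    simp only [hμ, map_mul, conj_ofReal, ← exp_conj, conj_I]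
    rw [mul_assoc, ← exp_add]
    simp
  have heq := isPreconnected_univ.eq_of_exp_eq (X := ℝ)
    (h := fun θ : ℝ => ℓ (μ θ) (τ (μ θ)) + θ * I)
    ((hlift.comp hμc).add (by fun_prop)).continuousOn (fun θ _ θ' _ => by rw [hconst, hconst])
    (mem_univ 0) (mem_univ (2 * Real.pi))
  have hμ2 : μ (2 * Real.pi) = μ 0 := by
    simp only [hμ, Subtype.mk.injEq]
    push_cast
    rw [exp_two_pi_mul_I]
    simp
  simp only [hμ2] at heq
  have := add_left_cancel heq
  simp [Real.pi_ne_zero] at this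

end Tangent

/-! ### Distance to the boundary -/

section BoundaryDist

variable {E : Type*} [NormedAddCommGroup E] [NormedSpace ℂ E] {D : Set E}

/-- The ball is connected, meets `D` and is disjoint from its frontier. -/
lemma ball_boundaryDist_subset (hD : IsOpen D) {z : E} (hz : z ∈ D) :
    ball z (boundaryDist D z) ⊆ D := by
  let _ : NormedSpace ℝ E := NormedSpace.complexToReal
  rcases le_or_gt (boundaryDist D z) 0 with h0 | h0
  · simp [ball_eq_empty.2 h0]
  refine (convex_ball z _).isPreconnected.subset_left_of_subset_union hD
    (isClosed_closure (s := D)).isOpen_compl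
    (disjoint_compl_right_iff_subset.2 subset_closure) (fun x hx => ?_) ⟨z, mem_ball_self h0, hz⟩
  by_contra hc
  simp only [mem_union, mem_compl_iff, not_or, not_not] at hc
  refine (disjoint_left.1 disjoint_ball_infDist hx) ?_
  rw [hD.frontier_eq]
  exact ⟨hc.2, hc.1⟩

lemma boundaryDist_le_of_notMem (hD : IsOpen D) {z x : E} (hz : z ∈ D) (hx : x ∉ D) :
    boundaryDist D z ≤ ‖z - x‖ := by
  by_contra! h
  exact hx (ball_boundaryDist_subset hD hz (by rwa [mem_ball, dist_eq_norm, norm_sub_rev]))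

lemma exists_boundaryDist_eq [ProperSpace E] (hD : IsOpen D) (hne : D ≠ univ) {z : E}
    (hz : z ∈ D) : ∃ p, p ∉ D ∧ boundaryDist D z = ‖z - p‖ := by
  let _ : NormedSpace ℝ E := NormedSpace.complexToReal
  obtain ⟨p, hp, h⟩ := (isClosed_frontier (s := D)).exists_infDist_eq_dist
    (nonempty_frontier_iff.2 ⟨⟨z, hz⟩, hne⟩) z
  rw [hD.frontier_eq] at hp
  exact ⟨p, hp.2, by rw [← dist_eq_norm]; exact h⟩

lemma boundaryDist_pos [ProperSpace E] (hD : IsOpen D) (hne : D ≠ univ) {z : E} (hz : z ∈ D) :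
    0 < boundaryDist D z := by
  obtain ⟨p, hp, h⟩ := exists_boundaryDist_eq hD hne hz
  rw [h]
  exact norm_pos_iff.2 (sub_ne_zero.2 (ne_of_mem_of_not_mem hz hp))

end BoundaryDist

/-! ### Half-planes and convex domains -/

section HalfPlane

/-- The lower bound of the Carathéodory distance in the right half-plane. -/
lemma log_le_caratheodoryDist_halfPlane {a b : ℂ} (ha : 0 < a.re) (hb : 0 < b.re) :
    ((1 / 2 * Real.log (1 + ‖a - b‖ / b.re) : ℝ) : EReal) ≤
      caratheodoryDist {x : ℂ | 0 < x.re} a b := by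
  have hne : ∀ x : ℂ, 0 < x.re → x + (starRingEnd ℂ) a ≠ 0 := fun x hx h => by
    have := congrArg re h
    simp at this
    linarith
  have hlt : ∀ x : ℂ, 0 < x.re → ‖x - a‖ < ‖x + (starRingEnd ℂ) a‖ := fun x hx => by
    refine lt_of_pow_lt_pow_left₀ 2 (norm_nonneg _) ?_
    rw [← normSq_eq_norm_sq, ← normSq_eq_norm_sq, normSq_apply, normSq_apply]
    simp only [sub_re, sub_im, add_re, add_im, conj_re, conj_im]
    nlinarith [mul_pos hx ha]
  refine le_trans ?_ (artanh_le_caratheodoryDist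
    (f := fun x => (x - a) / (x + (starRingEnd ℂ) a)) ?_ ?_ (by simp))
  · rw [EReal.coe_le_coe_iff]
    set s := ‖b - a‖ with hs
    set S := ‖b + (starRingEnd ℂ) a‖ with hS
    have hsS : s < S := hlt b hb
    have hs0 : 0 ≤ s := norm_nonneg _
    -- Since `artanh (s / S)` is half the logarithm of `1 + 2 * s / (S - s)`, the claim reduces to
    -- `S - s ≤ 2 * b.re`.
    have hS2 : S ≤ s + 2 * b.re := by
      have e : b + (starRingEnd ℂ) a = (starRingEnd ℂ) (a - b) + ((2 * b.re : ℝ) : ℂ) := by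
        rw [← add_conj, map_sub]
        ring
      rw [hS, e, hs, norm_sub_rev b a]
      refine (norm_add_le _ _).trans_eq ?_
      rw [norm_conj, norm_real, Real.norm_of_nonneg (by positivity)]
    have hq : s / S < 1 := (div_lt_one (hs0.trans_lt hsS)).2 hsS
    have hq0 : 0 ≤ s / S := div_nonneg hs0 (hs0.trans hsS.le)
    rw [norm_div, Real.artanh_eq_half_log ⟨by linarith, hq.le⟩, norm_sub_rev a b]
    have e : (1 + s / S) / (1 - s / S) = 1 + s / ((S - s) / 2) := by
      have h1 : S ≠ 0 := (hs0.trans_lt hsS).ne'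
      have h2 : S - s ≠ 0 := (sub_pos.2 hsS).ne'
      field_simp
      ring
    rw [e]
    have h3 : 0 < (S - s) / 2 := by linarith
    gcongr
    linarith
  · exact fun x hx => ((differentiableAt_id.sub_const a).div (differentiableAt_id.add_const _)
      (hne x hx)).differentiableWithinAt
  · intro x hx
    rw [mem_ball_zero_iff, norm_div, div_lt_one (norm_pos_iff.2 (hne x hx))]
    exact hlt x hx

variable {E : Type*} [NormedAddCommGroup E] [InnerProductSpace ℂ E] {D : Set E}

lemma exists_supporting_vector [CompleteSpace E] [Module ℝ E] [IsScalarTower ℝ ℂ E]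
    (hD : IsOpen D) (hconv : Convex ℝ D) {p : E} (hp : p ∉ D) :
    ∃ a : E, ∀ x ∈ D, 0 < (inner ℂ a (p - x)).re := by
  obtain ⟨F, hF⟩ := RCLike.geometric_hahn_banach_open_point (𝕜 := ℂ) hconv hD hp
  refine ⟨(InnerProductSpace.toDual ℂ E).symm F, fun x hx => ?_⟩
  rw [InnerProductSpace.toDual_symm_apply, map_sub, sub_re]
  exact sub_pos.2 (hF x hx)

lemma log_le_caratheodoryDist_of_supporting_vector {a p z w : E}
    (ha : ∀ x ∈ D, 0 < (inner ℂ a (p - x)).re) (hz : z ∈ D) (hw : w ∈ D) :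
    ((1 / 2 * Real.log (1 + ‖(inner ℂ a (z - w) : ℂ)‖ / (inner ℂ a (p - w)).re) : ℝ) : EReal) ≤
      caratheodoryDist D z w := by
  refine le_trans ?_ (caratheodoryDist_le_of_mapsTo (π := fun x => inner ℂ a (p - x))
    (G := {x : ℂ | 0 < x.re}) ?_ ha z w)
  · have e : inner ℂ a (p - z) - inner ℂ a (p - w) = -inner ℂ a (z - w) := by
      simp only [inner_sub_right]; ring
    have h := log_le_caratheodoryDist_halfPlane (ha z hz) (ha w hw)
    rwa [e, norm_neg] at h
  · have : (fun x => inner ℂ a (p - x)) = fun x => innerSL ℂ a (p - x) := by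
      funext x; rw [innerSL_apply_apply]
    rw [this]
    fun_prop

theorem Convex.log_div_le_caratheodoryDist [ProperSpace E] [Module ℝ E]
    [IsScalarTower ℝ ℂ E] (hD : IsOpen D) (hne : D ≠ univ) (hconv : Convex ℝ D) {z w : E}
    (hz : z ∈ D) (hw : w ∈ D) :
    ((1 / 2 * Real.log (boundaryDist D z / boundaryDist D w) : ℝ) : EReal) ≤
      caratheodoryDist D z w := by
  obtain ⟨p, hp, hdw⟩ := exists_boundaryDist_eq hD hne hw
  obtain ⟨a, ha⟩ := exists_supporting_vector hD hconv hp
  refine le_trans ?_ (log_le_caratheodoryDist_of_supporting_vector ha hz hw)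
  have hw0 := boundaryDist_pos hD hne hw
  have hz0 := boundaryDist_pos hD hne hz
  have ha0 : 0 < ‖a‖ := norm_pos_iff.2 (by rintro rfl; simpa using ha z hz)
  set hr := (inner ℂ a (p - w)).re with hhr
  have hr0 : 0 < hr := ha w hw
  have hrw : hr ≤ ‖a‖ * boundaryDist D w := by
    rw [hdw, norm_sub_rev]
    exact (re_le_norm _).trans (norm_inner_le_norm _ _)
  set kr := (inner ℂ a (p - z)).re with hkr
  have hk0 : 0 < kr := ha z hz
  -- The orthogonal projection of `z` to the supporting hyperplane is outside `D`, so the distance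
  -- to the hyperplane bounds `boundaryDist D z` from above.
  have hrz : ‖a‖ * boundaryDist D z ≤ kr := by
    set z' := z + ((kr / ‖a‖ ^ 2 : ℝ) : ℂ) • a with hz'
    have hz'D : z' ∉ D := fun h => by
      have h1 := ha z' h
      have e : p - z' = (p - z) - ((kr / ‖a‖ ^ 2 : ℝ) : ℂ) • a := by rw [hz']; abel
      rw [e, inner_sub_right, inner_smul_right, inner_self_eq_norm_sq_to_K, sub_re, ← hkr] at h1
      have e2 : (((kr / ‖a‖ ^ 2 : ℝ) : ℂ) * (‖a‖ : ℂ) ^ 2).re = kr := by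
        rw [← ofReal_pow, ← ofReal_mul, ofReal_re]
        field_simp
      change 0 < kr - (((kr / ‖a‖ ^ 2 : ℝ) : ℂ) * (‖a‖ : ℂ) ^ 2).re at h1
      rw [e2] at h1
      linarith
    have h2 := boundaryDist_le_of_notMem hD hz hz'D
    rw [hz', sub_add_cancel_left, norm_neg, norm_smul, norm_real,
      Real.norm_of_nonneg (by positivity)] at h2
    calc ‖a‖ * boundaryDist D z ≤ ‖a‖ * (kr / ‖a‖ ^ 2 * ‖a‖) := by gcongr
      _ = kr := by field_simp
  have hkh : kr ≤ hr + ‖(inner ℂ a (z - w) : ℂ)‖ := by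
    have e : kr = hr - (inner ℂ a (z - w)).re := by
      rw [hkr, hhr, ← sub_re, ← inner_sub_right]
      congr 2
      abel
    have := (neg_le_abs _).trans (abs_re_le_norm (inner ℂ a (z - w)))
    linarith
  refine EReal.coe_le_coe_iff.2 ?_
  gcongr
  rw [div_le_iff₀ hw0]
  have h5 : boundaryDist D z * hr ≤ kr * boundaryDist D w := by
    have h6 : ‖a‖ * boundaryDist D z * hr ≤ kr * (‖a‖ * boundaryDist D w) := by gcongr
    have h7 : ‖a‖ * (boundaryDist D z * hr) ≤ ‖a‖ * (kr * boundaryDist D w) := by linarith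
    exact le_of_mul_le_mul_left h7 ha0
  have h8 : boundaryDist D z ≤ kr / hr * boundaryDist D w := by
    rw [div_mul_eq_mul_div, le_div_iff₀ hr0]
    exact h5
  refine h8.trans ?_
  gcongr
  rw [div_le_iff₀ hr0, add_mul, one_mul, div_mul_cancel₀ _ hr0.ne']
  exact hkh

/-- In dimension one the Cauchy–Schwarz inequality for `inner ℂ a (z - w)` is an equality, so no
part of `‖z - w‖` is lost. -/
theorem Convex.log_one_add_le_caratheodoryDist {D : Set ℂ} (hD : IsOpen D) (hne : D ≠ univ)
    (hconv : Convex ℝ D) {z w : ℂ} (hz : z ∈ D) (hw : w ∈ D) :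
    ((1 / 2 * Real.log (1 + ‖z - w‖ / boundaryDist D w) : ℝ) : EReal) ≤
      caratheodoryDist D z w := by
  obtain ⟨p, hp, hdw⟩ := exists_boundaryDist_eq hD hne hw
  obtain ⟨a, ha⟩ := exists_supporting_vector hD hconv hp
  refine le_trans ?_ (log_le_caratheodoryDist_of_supporting_vector ha hz hw)
  have hw0 := boundaryDist_pos hD hne hw
  have hr0 := ha w hw
  have hrw : (inner ℂ a (p - w)).re ≤ ‖a‖ * boundaryDist D w := by
    rw [hdw, norm_sub_rev]
    exact (re_le_norm _).trans (norm_inner_le_norm _ _)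
  refine EReal.coe_le_coe_iff.2 ?_
  have e : ‖(inner ℂ a (z - w) : ℂ)‖ = ‖a‖ * ‖z - w‖ := by
    rw [RCLike.inner_apply, norm_mul, RCLike.norm_conj, mul_comm]
  rw [e]
  gcongr 1 / 2 * Real.log (1 + ?_)
  rw [div_le_div_iff₀ hw0 hr0]
  calc ‖z - w‖ * (inner ℂ a (p - w)).re ≤ ‖z - w‖ * (‖a‖ * boundaryDist D w) := by gcongr
    _ = ‖a‖ * ‖z - w‖ * boundaryDist D w := by ring

end HalfPlane

/-! ### Bounds for ℂ-convex domains -/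

section CConvexBound

variable {E : Type*} [NormedAddCommGroup E] [InnerProductSpace ℂ E] {D : Set E}

theorem IsCConvex.log_div_le_caratheodoryDist [ProperSpace E] (hD : IsCConvex D)
    (hne : D ≠ univ) {z w : E} (hz : z ∈ D) (hw : w ∈ D) :
    ((1 / 4 * Real.log (boundaryDist D z / boundaryDist D w) : ℝ) : EReal) ≤
      caratheodoryDist D z w := by
  obtain ⟨p, hp, hdw⟩ := exists_boundaryDist_eq hD.1 hne hw
  have hw0 := boundaryDist_pos hD.1 hne hw
  have hz0 := boundaryDist_pos hD.1 hne hz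
  have hball : ball w ‖w - p‖ ⊆ D := hdw ▸ ball_boundaryDist_subset hD.1 hw
  set a := w - p with ha
  have ha0 : a ≠ 0 := sub_ne_zero.2 (ne_of_mem_of_not_mem hw hp)
  have hapos : 0 < ‖a‖ := norm_pos_iff.2 ha0
  have hmiss : ∀ x ∈ D, inner ℂ a (x - p) ≠ 0 := fun x hx => hD.inner_ne_zero hw hp hball hx
  set π : E →L[ℂ] ℂ := innerSL ℂ a with hπ
  have hπa : ∀ x y, π x - π y = inner ℂ a (x - y) := fun x y => by
    rw [hπ, innerSL_apply_apply, innerSL_apply_apply, inner_sub_right]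
  have hπ0 : π ≠ 0 := fun h => ha0 (by
    have : π a = 0 := by rw [h]; rfl
    rw [hπ, innerSL_apply_apply] at this
    exact inner_self_eq_zero.1 this)
  have hpG : π p ∉ π '' D := by
    rintro ⟨x, hx, h⟩
    exact hmiss x hx (by rw [← hπa, h, sub_self])
  have h1 := (hD.hasLogs_image hπ0).log_le_caratheodoryDist
    (π.isOpenMap_of_ne_zero hπ0 D hD.1) hpG (mem_image_of_mem π hz) (mem_image_of_mem π hw)
  refine le_trans ?_ (h1.trans (caratheodoryDist_le_of_mapsTo π.differentiable.differentiableOn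
    (mapsTo_image _ _) z w))
  refine EReal.coe_le_coe_iff.2 ?_
  gcongr
  have hwp : ‖π w - π p‖ = ‖a‖ ^ 2 := by
    rw [hπa, ← ha, inner_self_eq_norm_sq_to_K]
    simp
  -- The orthogonal projection of `z` to the complex tangent hyperplane is outside `D`, at distance
  -- `‖π z - π p‖ / ‖a‖` from `z`.
  have hzp : boundaryDist D z * ‖a‖ ≤ ‖π z - π p‖ := by
    set z' := z - (inner ℂ a (z - p) / (‖a‖ : ℂ) ^ 2) • a with hz'
    have hz'D : z' ∉ D := fun h => hmiss z' h (by
      have e : z' - p = (z - p) - (inner ℂ a (z - p) / (‖a‖ : ℂ) ^ 2) • a := by rw [hz']; abel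
      rw [e, inner_sub_right, inner_smul_right, inner_self_eq_norm_sq_to_K]
      have : (‖a‖ : ℂ) ≠ 0 := by exact_mod_cast hapos.ne'
      simp only [coe_algebraMap]
      rw [div_mul_cancel₀ _ (pow_ne_zero 2 this), sub_self])
    have h2 := boundaryDist_le_of_notMem hD.1 hz hz'D
    rw [hz', sub_sub_cancel, norm_smul, norm_div, norm_pow, norm_real, norm_norm, ← hπa] at h2
    calc boundaryDist D z * ‖a‖ ≤ ‖π z - π p‖ / ‖a‖ ^ 2 * ‖a‖ * ‖a‖ := by gcongr
      _ = ‖π z - π p‖ := by field_simp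
  have htri : ‖π z - π p‖ ≤ ‖π z - π w‖ + ‖π w - π p‖ := norm_sub_le_norm_sub_add_norm_sub _ _ _
  rw [hwp] at htri
  rw [hwp, hdw, div_le_iff₀ hapos]
  have : boundaryDist D z * ‖a‖ ≤ (1 + ‖π z - π w‖ / ‖a‖ ^ 2) * ‖a‖ * ‖a‖ := by
    calc _ ≤ ‖π z - π w‖ + ‖a‖ ^ 2 := hzp.trans htri
      _ = _ := by field_simp; ring
  exact le_of_mul_le_mul_right this hapos

theorem IsCConvex.log_one_add_le_caratheodoryDist {D : Set ℂ} (hD : IsCConvex D)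
    (hne : D ≠ univ) {z w : ℂ} (hz : z ∈ D) (hw : w ∈ D) :
    ((1 / 4 * Real.log (1 + ‖z - w‖ / boundaryDist D w) : ℝ) : EReal) ≤
      caratheodoryDist D z w := by
  obtain ⟨p, hp, hdw⟩ := exists_boundaryDist_eq hD.1 hne hw
  have hlog : HasLogs D := by
    have h := hD.hasLogs_image (π := ContinuousLinearMap.id ℂ ℂ)
      (fun h => one_ne_zero (congrArg (fun f : ℂ →L[ℂ] ℂ => f 1) h))
    simpa using h
  rw [hdw]
  exact hlog.log_le_caratheodoryDist hD.1 hp hz hw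

end CConvexBound

/-! ### Sharpness of the constants -/

section Sharpness

lemma boundaryDist_ball_ofReal {t : ℝ} (ht0 : 0 ≤ t) (ht1 : t < 1) :
    boundaryDist (ball (0 : ℂ) 1) t = 1 - t := by
  have h1 : (1 : ℂ) ∈ sphere (0 : ℂ) 1 := by simp
  rw [boundaryDist, frontier_ball _ one_ne_zero]
  refine le_antisymm ?_ ((le_infDist ⟨1, h1⟩).2 fun y hy => ?_)
  · refine (infDist_le_dist_of_mem h1).trans_eq ?_
    rw [dist_eq_norm, norm_sub_rev, ← ofReal_one, ← ofReal_sub, norm_real,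
      Real.norm_of_nonneg (by linarith)]
  · have h2 := norm_sub_norm_le y (t : ℂ)
    rw [mem_sphere_zero_iff_norm.1 hy, norm_real, Real.norm_of_nonneg ht0] at h2
    rwa [dist_eq_norm, norm_sub_rev]

/-- A holomorphic map of the unit disc into `D` bounds the Carathéodory distance from above. -/
lemma caratheodoryDist_le_artanh {D : Set ℂ} {g : ℂ → ℂ} (hg : DifferentiableOn ℂ g (ball 0 1))
    (hgD : MapsTo g (ball 0 1) D) {ζ : ℂ} (hζ : ‖ζ‖ < 1) :
    caratheodoryDist D (g 0) (g ζ) ≤ ((Real.artanh ‖ζ‖ : ℝ) : EReal) := by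
  refine sSup_le ?_
  rintro _ ⟨f, hf, hfD, hf0, rfl⟩
  have h := norm_le_norm_of_mapsTo_ball (f := f ∘ g) (hf.comp hg hgD)
    ((hfD.comp hgD).mono_right ball_subset_closedBall) hf0 hζ
  exact EReal.coe_le_coe_iff.2
    (Real.artanh_le_artanh (by linarith [norm_nonneg (f (g ζ))]) hζ h)

lemma exists_artanh_lt {C : ℝ} (hC : 1 / 2 < C) :
    ∃ t ∈ Ioo (0 : ℝ) 1, Real.artanh t < C * Real.log (1 / (1 - t)) := by
  -- With `1 - t = exp (-X)`, `artanh t` is less than `(log 2 + X) / 2`, and this `X` makes that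
  -- bound equal to `C * X`.
  set X := Real.log 2 / (2 * C - 1) with hX
  have hl : 0 < Real.log 2 := Real.log_pos (by norm_num)
  have hd : 0 < 2 * C - 1 := by linarith
  have hX0 : 0 < X := div_pos hl hd
  have hXe : X * (2 * C - 1) = Real.log 2 := div_mul_cancel₀ _ hd.ne'
  have he : Real.exp (-X) < 1 := by rw [← Real.exp_zero]; exact Real.exp_lt_exp.2 (by linarith)
  have hep := Real.exp_pos (-X)
  refine ⟨1 - Real.exp (-X), ⟨by linarith, by linarith⟩, ?_⟩
  rw [Real.artanh_eq_half_log ⟨by linarith, by linarith⟩, sub_sub_cancel, one_div (Real.exp (-X)), Real.log_inv,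
    Real.log_exp, Real.log_div (by linarith) hep.ne', Real.log_exp]
  have h3 : Real.log (1 + (1 - Real.exp (-X))) < Real.log 2 :=
    Real.log_lt_log (by linarith) (by linarith)
  linarith

lemma mem_slitDomain_iff {ζ : ℂ} : ζ ∈ slitDomain ↔ -ζ ∈ slitPlane := by
  rw [mem_slitPlane_iff, slitDomain, mem_ofPred_eq, neg_re, neg_im, neg_ne_zero, not_and_or, not_le,
    neg_pos]

lemma isOpen_slitDomain : IsOpen slitDomain := by
  have e : slitDomain = (fun ζ : ℂ => -ζ) ⁻¹' slitPlane := by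
    ext ζ; exact mem_slitDomain_iff
  rw [e]
  exact isOpen_slitPlane.preimage continuous_neg

lemma isSimplyConnected_slitDomain : IsSimplyConnected slitDomain := by
  have h : IsSimplyConnected slitPlane := by
    have := starConvex_one_slitPlane.contractibleSpace ⟨1, one_mem_slitPlane⟩
    exact SimplyConnectedSpace.ofContractible slitPlane
  have e : slitDomain = (Homeomorph.neg ℂ) ⁻¹' slitPlane := by
    ext ζ; exact mem_slitDomain_iff
  rw [e]
  exact (Homeomorph.neg ℂ).isSimplyConnected_preimage.2 h

lemma isCConvex_slitDomain : IsCConvex slitDomain := by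
  refine ⟨isOpen_slitDomain, fun a v hv _ => ?_⟩
  have e : complexLine a v = univ := by
    refine eq_univ_of_forall fun x => ⟨(x - a) / v, ?_⟩
    simp only [smul_eq_mul]
    rw [div_mul_cancel₀ _ hv]
    ring
  rw [e, inter_univ]
  exact isSimplyConnected_slitDomain

lemma zero_notMem_slitDomain : (0 : ℂ) ∉ slitDomain := by simp [slitDomain]

lemma neg_ofReal_mem_slitDomain {a : ℝ} (ha : 0 < a) : (-a : ℂ) ∈ slitDomain := by
  rw [mem_slitDomain_iff, neg_neg]
  exact ofReal_mem_slitPlane.2 ha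

lemma boundaryDist_slitDomain {a : ℝ} (ha : 0 < a) : boundaryDist slitDomain (-a : ℂ) = a := by
  have hmem := neg_ofReal_mem_slitDomain ha
  refine le_antisymm ?_ ?_
  · have h := boundaryDist_le_of_notMem isOpen_slitDomain hmem zero_notMem_slitDomain
    rwa [sub_zero, norm_neg, norm_real, Real.norm_of_nonneg ha.le] at h
  · obtain ⟨p, hp, h⟩ := exists_boundaryDist_eq isOpen_slitDomain
      (fun h => zero_notMem_slitDomain (h ▸ mem_univ _)) hmem
    rw [h]
    simp only [slitDomain, mem_ofPred_eq, not_not] at hp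
    have h1 := (neg_le_abs _).trans (abs_re_le_norm (-(a : ℂ) - p))
    simp only [sub_re, neg_re, ofReal_re] at h1
    linarith [hp.1]

lemma caratheodoryDist_slitDomain_le :
    caratheodoryDist slitDomain (-(1 : ℝ) : ℂ) (-(1 / 4 : ℝ) : ℂ) ≤
      ((1 / 4 * Real.log 4 : ℝ) : EReal) := by
  have hne : ∀ ζ ∈ ball (0 : ℂ) 1, 1 - ζ ≠ 0 := fun ζ hζ h => by
    rw [← sub_eq_zero.1 h] at hζ
    simp at hζ
  -- The square of the Cayley map, negated, sends the disc into the slit plane, 0 to -1 and -1/3 to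
  -- -1/4; moreover `artanh (1/3) = log 2 / 2 = log 4 / 4`.
  have h := caratheodoryDist_le_artanh (D := slitDomain)
    (g := fun ζ => -((1 + ζ) / (1 - ζ)) ^ 2) (ζ := -(1 / 3 : ℝ)) ?_ ?_ ?_
  · have e1 : (-((1 + 0) / (1 - 0)) ^ 2 : ℂ) = -(1 : ℝ) := by norm_num
    have e2 : (-((1 + -((1 / 3 : ℝ) : ℂ)) / (1 - -((1 / 3 : ℝ) : ℂ))) ^ 2 : ℂ) =
        -((1 / 4 : ℝ) : ℂ) := by
      push_cast
      norm_num
    rw [e1, e2] at h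
    refine h.trans_eq ?_
    congr 1
    rw [norm_neg, norm_real, Real.norm_of_nonneg (by norm_num),
      Real.artanh_eq_half_log ⟨by norm_num, by norm_num⟩,
      show ((4 : ℝ)) = 2 ^ 2 by norm_num, Real.log_pow,
      show ((1 + 1 / 3 : ℝ) / (1 - 1 / 3)) = 2 by norm_num]
    push_cast
    ring
  · exact (((differentiableOn_id.const_add 1).div (differentiableOn_id.const_sub 1) hne).fun_pow
      2).fun_neg
  · intro ζ hζ
    rw [mem_slitDomain_iff, neg_neg]
    have hre : 0 < ((1 + ζ) / (1 - ζ)).re := by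
      have h1 : normSq ζ < 1 := by
        rw [normSq_eq_norm_sq]
        have := mem_ball_zero_iff.1 hζ
        nlinarith [norm_nonneg ζ]
      rw [normSq_apply] at h1
      have h2 : 0 < normSq (1 - ζ) := normSq_pos.2 (hne ζ hζ)
      rw [div_re, ← add_div]
      refine div_pos ?_ h2
      simp only [add_re, sub_re, add_im, sub_im, one_re, one_im]
      nlinarith
    set u := (1 + ζ) / (1 - ζ) with hu
    rw [mem_slitPlane_iff, pow_two, mul_re, mul_im]
    by_cases him : u.im = 0
    · left
      rw [him]
      nlinarith [mul_pos hre hre]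
    · right
      have : u.re * u.im ≠ 0 := mul_ne_zero hre.ne' him
      intro h0
      exact this (by linarith)
  · rw [norm_neg, norm_real, Real.norm_of_nonneg] <;> norm_num

end Sharpness

end

theorem proposition2 :
    -- (i) proper convex domains in `ℂⁿ`
    ((∀ (n : ℕ) (D : Set (EuclideanSpace ℂ (Fin n))),
        IsDomainSet D → D ≠ Set.univ → Convex ℝ D → ∀ z ∈ D, ∀ w ∈ D,
          ((1 / 2 * Real.log (boundaryDist D z / boundaryDist D w) : ℝ) : EReal)
            ≤ caratheodoryDist D z w) ∧
      -- the case `n = 1`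
      (∀ D : Set ℂ, IsDomainSet D → D ≠ Set.univ → Convex ℝ D → ∀ z ∈ D, ∀ w ∈ D,
          ((1 / 2 * Real.log (1 + ‖z - w‖ / boundaryDist D w) : ℝ) : EReal)
            ≤ caratheodoryDist D z w)) ∧
    -- (ii) proper `ℂ`-convex domains in `ℂⁿ`
    ((∀ (n : ℕ) (D : Set (EuclideanSpace ℂ (Fin n))),
        IsDomainSet D → D ≠ Set.univ → IsCConvex D → ∀ z ∈ D, ∀ w ∈ D,
          ((1 / 4 * Real.log (boundaryDist D z / boundaryDist D w) : ℝ) : EReal)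
            ≤ caratheodoryDist D z w) ∧
      -- the case `n = 1`
      (∀ D : Set ℂ, IsDomainSet D → D ≠ Set.univ → IsCConvex D → ∀ z ∈ D, ∀ w ∈ D,
          ((1 / 4 * Real.log (1 + ‖z - w‖ / boundaryDist D w) : ℝ) : EReal)
            ≤ caratheodoryDist D z w)) ∧
    -- the constant `1 / 2` is sharp: the unit disc
    (∀ C : ℝ, 1 / 2 < C →
      (∃ z ∈ Metric.ball (0 : ℂ) 1, ∃ w ∈ Metric.ball (0 : ℂ) 1,
        caratheodoryDist (Metric.ball (0 : ℂ) 1) z w <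
          ((C * Real.log (boundaryDist (Metric.ball (0 : ℂ) 1) z /
            boundaryDist (Metric.ball (0 : ℂ) 1) w) : ℝ) : EReal)) ∧
      (∃ z ∈ Metric.ball (0 : ℂ) 1, ∃ w ∈ Metric.ball (0 : ℂ) 1,
        caratheodoryDist (Metric.ball (0 : ℂ) 1) z w <
          ((C * Real.log (1 + ‖z - w‖ / boundaryDist (Metric.ball (0 : ℂ) 1) w) : ℝ) :
            EReal))) ∧
    -- the constant `1 / 4` is sharp: the plane slit along a half-line
    (IsDomainSet slitDomain ∧ slitDomain ≠ Set.univ ∧ IsCConvex slitDomain ∧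
      ∀ C : ℝ, 1 / 4 < C →
        (∃ z ∈ slitDomain, ∃ w ∈ slitDomain,
          caratheodoryDist slitDomain z w <
            ((C * Real.log (boundaryDist slitDomain z / boundaryDist slitDomain w) : ℝ) :
              EReal)) ∧
        (∃ z ∈ slitDomain, ∃ w ∈ slitDomain,
          caratheodoryDist slitDomain z w <
            ((C * Real.log (1 + ‖z - w‖ / boundaryDist slitDomain w) : ℝ) : EReal))) := by

  refine ⟨⟨fun n D hD hne hconv z hz w hw => hconv.log_div_le_caratheodoryDist hD.1 hne hz hw,
      fun D hD hne hconv z hz w hw => hconv.log_one_add_le_caratheodoryDist hD.1 hne hz hw⟩,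
    ⟨fun n D _ hne hconv z hz w hw => hconv.log_div_le_caratheodoryDist hne hz hw,
      fun D _ hne hconv z hz w hw => hconv.log_one_add_le_caratheodoryDist hne hz hw⟩,
    fun C hC => ?_, ⟨isOpen_slitDomain, isSimplyConnected_slitDomain.isPathConnected.isConnected⟩,
    fun h => zero_notMem_slitDomain (h ▸ Set.mem_univ _), isCConvex_slitDomain, fun C hC => ?_⟩
  · obtain ⟨t, ⟨ht0, ht1⟩, ht⟩ := exists_artanh_lt hC
    have h0 : (0 : ℂ) ∈ Metric.ball (0 : ℂ) 1 := Metric.mem_ball_self one_pos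
    have hnt : ‖(t : ℂ)‖ = t := by rw [Complex.norm_real, Real.norm_of_nonneg ht0.le]
    have htm : (t : ℂ) ∈ Metric.ball (0 : ℂ) 1 := by rwa [mem_ball_zero_iff, hnt]
    have hle : caratheodoryDist (Metric.ball (0 : ℂ) 1) 0 t ≤ ((Real.artanh t : ℝ) : EReal) := by
      have h := caratheodoryDist_le_artanh (g := fun ζ => ζ) differentiableOn_id
        (Set.mapsTo_id (Metric.ball (0 : ℂ) 1)) (ζ := t) (by rwa [hnt])
      rwa [hnt] at h
    have hd0 : boundaryDist (Metric.ball (0 : ℂ) 1) 0 = 1 := by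
      simpa using boundaryDist_ball_ofReal le_rfl one_pos
    have hdt := boundaryDist_ball_ofReal ht0.le ht1
    have h1t : 1 - t ≠ 0 := by linarith
    -- For the pair `0, t` both logarithms have the same argument `1 / (1 - t)`.
    refine ⟨⟨0, h0, t, htm, hle.trans_lt (EReal.coe_lt_coe_iff.2 ?_)⟩,
      ⟨0, h0, t, htm, hle.trans_lt (EReal.coe_lt_coe_iff.2 ?_)⟩⟩
    · rwa [hd0, hdt]
    · rw [hdt, zero_sub, norm_neg, hnt]
      have e : 1 + t / (1 - t) = 1 / (1 - t) := by field_simp; ring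
      rwa [e]
  · have hl : 0 < Real.log 4 := Real.log_pos (by norm_num)
    have h1 : boundaryDist slitDomain (-(1 : ℝ) : ℂ) = 1 := boundaryDist_slitDomain one_pos
    have h4 : boundaryDist slitDomain (-(1 / 4 : ℝ) : ℂ) = 1 / 4 :=
      boundaryDist_slitDomain (by norm_num)
    have hm1 : (-(1 : ℝ) : ℂ) ∈ slitDomain := neg_ofReal_mem_slitDomain one_pos
    have hm4 : (-(1 / 4 : ℝ) : ℂ) ∈ slitDomain := neg_ofReal_mem_slitDomain (by norm_num)
    have hlt : 1 / 4 * Real.log 4 < C * Real.log 4 := by gcongr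
    -- For -1 and -1/4 both arguments equal 4: the ratio of the distances, and `1 + (3/4) / (1/4)`.
    refine ⟨⟨_, hm1, _, hm4, caratheodoryDist_slitDomain_le.trans_lt (EReal.coe_lt_coe_iff.2 ?_)⟩,
      ⟨_, hm1, _, hm4, caratheodoryDist_slitDomain_le.trans_lt (EReal.coe_lt_coe_iff.2 ?_)⟩⟩
    · rw [h1, h4]
      convert hlt using 3
      norm_num
    · have e : ‖(-(1 : ℝ) : ℂ) - (-(1 / 4 : ℝ) : ℂ)‖ = 3 / 4 := by
        rw [← Complex.ofReal_neg, ← Complex.ofReal_neg, ← Complex.ofReal_sub, Complex.norm_real]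
        norm_num
      rw [h4, e]
      convert hlt using 3
      norm_num
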